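/- Let $n\ge 2$ and let $\mathcal U\subset\mathbb R^n$ be a bounded open convex set. Let $F$ be a strongly convex Finsler metric on $\mathcal U$, i.e. a continuous function $F:\mathcal U\times\mathbb R^n\to[0,\infty)$ which is smooth on $\{(x,y): y\neq 0\}$, such that each $F(x,\cdot)$ is subadditive, positively homogeneous of degree $1$ and positive on nonzero vectors, and whose fundamental tensor $g_{ij}(x,y)=\frac12\frac{\partial^2F^2}{\partial y^i\partial y^j}(x,y)$ is positive definite for all $x\in\mathcal U$, $y\ne0$. Then the following are equivalent. (1) $F$ is the Hilbert metric of $\mathcal U$, i.e. $F(x,\xi)=\frac12\big(F_f(x,\xi)+F_f(x,-\xi)\big)$ for all $x\in\mathcal U$, $\xi\in\mathbb R^n$, where $F_f(x,\xi)=\inf\{t>0: x+\xi/t\in\mathcal U\}$. (2) $F$ has the following three properties. - $F$ is projectively flat: for all $p\neq q$ in $\mathcal U$, the affine segment from $p$ to $q$ can be parametrized as a geodesic, i.e. as a $C^1$ curve $\beta:[a,b]\to\mathcal U$ that is a critical point, among curves with fixed end points, of the energy $\int_a^bF(\beta,\dot\beta)^2\,ds$. - $F$ is forward and backward complete. That is,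 with $d(p,q)$ the infimum of the lengths $\int_0^1F(\beta,\dot\beta)\,ds$ of the smooth curves $\beta:[0,1]\to\mathcal U$ from $p$ to $q$, a sequence $(x_i)$ in $\mathcal U$ converges to a point of $\mathcal U$ as soon as it is forward Cauchy (for every $\varepsilon>0$ there is $N$ with $d(x_i,x_{i+k})<\varepsilon$ for all $i\ge N$, $k\ge0$) or backward Cauchy (the same with $d(x_{i+k},x_i)<\varepsilon$). - $F$ has constant flag curvature $\mathbf K=-1$: for all $x\in\mathcal U$ and all linearly independent $y,w\in\mathbb R^n$, $$\frac{g_{im}R^i{}_k\,w^kw^m}{F^2\,g_{ij}w^iw^j-(g_{ij}w^iy^j)^2}=-1\quad\text{at }(x,y),$$ where $R^i{}_k=2\frac{\partial G^i}{\partial x^k}-\frac{\partial^2G^i}{\partial x^j\partial y^k}y^j+2G^j\frac{\partial^2G^i}{\partial y^j\partial y^k}-\frac{\partial G^i}{\partial y^j}\frac{\partial G^j}{\partial y^k}$ is the Riemann curvature, $G^k=\frac14g^{km}\big(\frac{\partial g_{im}}{\partial x^j}+\frac{\partial g_{jm}}{\partial x^i}-\frac{\partial g_{ij}}{\partial x^m}\big)y^iy^j$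 are the spray coefficients, $(g^{km})$ is the inverse of $(g_{km})$, and repeated indices are summed. -/

import Mathlib

namespace Finsler

open Set Filter Topology
open scoped ContDiff

/-- The model space `ℝⁿ`. A Finsler metric on an open set `U ⊆ ℝⁿ` is a function
`F : ℝⁿ → ℝⁿ → ℝ`, `F x ξ` being the length of the tangent vector `ξ` at `x`;
only its values at points `x ∈ U` matter. -/
abbrev Space (n : ℕ) : Type := EuclideanSpace ℝ (Fin n)

/-- The `i`-th standard basis vector. -/
noncomputable def basisVec {n : ℕ} (i : Fin n) : Space n := EuclideanSpace.single i 1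

/-- `∂f/∂xⁱ` for a function `f (x, y)` of base point and vector. -/
noncomputable def partialX {n : ℕ} (i : Fin n) (f : Space n → Space n → ℝ) :
    Space n → Space n → ℝ :=
  fun x y => fderiv ℝ (fun z => f z y) x (basisVec i)

/-- `∂f/∂yⁱ` for a function `f (x, y)` of base point and vector. -/
noncomputable def partialY {n : ℕ} (i : Fin n) (f : Space n → Space n → ℝ) :
    Space n → Space n → ℝ :=
  fun x y => fderiv ℝ (fun v => f x v) y (basisVec i)

/-! ### Finsler metrics -/

/-- `F` is a Finsler structure on `U`: finite, continuous, positive off the zero section and,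
at each point, subadditive and positively homogeneous. -/
structure IsFinslerMetric {n : ℕ} (U : Set (Space n)) (F : Space n → Space n → ℝ) : Prop where
  continuousOn : ContinuousOn (fun p : Space n × Space n => F p.1 p.2) (U ×ˢ univ)
  pos : ∀ x ∈ U, ∀ ξ : Space n, ξ ≠ 0 → 0 < F x ξ
  add_le : ∀ x ∈ U, ∀ ξ η : Space n, F x (ξ + η) ≤ F x ξ + F x η
  smul : ∀ x ∈ U, ∀ c : ℝ, 0 ≤ c → ∀ ξ : Space n, F x (c • ξ) = c * F x ξ

/-- The fundamental tensor `g_ij (x, y) = ½ ∂²F²/∂yⁱ∂yʲ`. -/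
noncomputable def fundamentalTensor {n : ℕ} (F : Space n → Space n → ℝ) (x y : Space n) :
    Matrix (Fin n) (Fin n) ℝ :=
  Matrix.of fun i j => (1 / 2 : ℝ) * partialY i (partialY j fun z v => F z v ^ 2) x y

/-- `F` is a strongly convex Finsler metric on `U`: smooth on the slit tangent bundle, with
positive definite fundamental tensor there. -/
structure IsStronglyConvex {n : ℕ} (U : Set (Space n)) (F : Space n → Space n → ℝ) : Prop
    extends IsFinslerMetric U F where
  smooth : ContDiffOn ℝ ∞ (fun p : Space n × Space n => F p.1 p.2) (U ×ˢ {0}ᶜ)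
  posDef : ∀ x ∈ U, ∀ y : Space n, y ≠ 0 → (fundamentalTensor F x y).PosDef

/-! ### Length, distance, completeness -/

/-- The length of the curve `β : [a, b] → ℝⁿ`. -/
noncomputable def length {n : ℕ} (F : Space n → Space n → ℝ) (a b : ℝ) (β : ℝ → Space n) : ℝ :=
  ∫ s in a..b, F (β s) (derivWithin β (Icc a b) s)

/-- The distance `d_F (p, q)`: the infimum of the lengths of the smooth curves `[0, 1] → U`
from `p` to `q`. -/
noncomputable def finslerDist {n : ℕ} (U : Set (Space n)) (F : Space n → Space n → ℝ)
    (p q : Space n) : ℝ :=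
  sInf {l : ℝ | ∃ β : ℝ → Space n, ContDiffOn ℝ ∞ β (Icc 0 1) ∧ (∀ s ∈ Icc (0 : ℝ) 1, β s ∈ U) ∧
    β 0 = p ∧ β 1 = q ∧ l = length F 0 1 β}

/-- Every forward Cauchy sequence in `U` converges to a point of `U`. -/
def IsForwardComplete {n : ℕ} (U : Set (Space n)) (F : Space n → Space n → ℝ) : Prop :=
  ∀ x : ℕ → Space n, (∀ i, x i ∈ U) →
    (∀ ε : ℝ, 0 < ε → ∃ N : ℕ, ∀ i, N ≤ i → ∀ k, finslerDist U F (x i) (x (i + k)) < ε) →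
    ∃ z ∈ U, Tendsto x atTop (𝓝 z)

/-- Every backward Cauchy sequence in `U` converges to a point of `U`. -/
def IsBackwardComplete {n : ℕ} (U : Set (Space n)) (F : Space n → Space n → ℝ) : Prop :=
  ∀ x : ℕ → Space n, (∀ i, x i ∈ U) →
    (∀ ε : ℝ, 0 < ε → ∃ N : ℕ, ∀ i, N ≤ i → ∀ k, finslerDist U F (x (i + k)) (x i) < ε) →
    ∃ z ∈ U, Tendsto x atTop (𝓝 z)

/-- Forward and backward completeness. -/
def IsComplete {n : ℕ} (U : Set (Space n)) (F : Space n → Space n → ℝ) : Prop :=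
  IsForwardComplete U F ∧ IsBackwardComplete U F

/-! ### Geodesics, projective flatness -/

/-- The energy of the curve `β : [a, b] → ℝⁿ`. -/
noncomputable def energy {n : ℕ} (F : Space n → Space n → ℝ) (a b : ℝ) (β : ℝ → Space n) : ℝ :=
  ∫ s in a..b, F (β s) (derivWithin β (Icc a b) s) ^ 2

/-- The `C¹` curve `β : [a, b] → U` is a geodesic: it is a critical point of the energy with
respect to all `C¹` variations `β + ε η` with fixed end points. -/
structure IsGeodesic {n : ℕ} (U : Set (Space n)) (F : Space n → Space n → ℝ) (a b : ℝ)
    (β : ℝ → Space n) : Prop where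
  contDiffOn : ContDiffOn ℝ 1 β (Icc a b)
  mem : ∀ s ∈ Icc a b, β s ∈ U
  critical : ∀ η : ℝ → Space n, ContDiffOn ℝ 1 η (Icc a b) → η a = 0 → η b = 0 →
    HasDerivAt (fun ε : ℝ => energy F a b (fun s => β s + ε • η s)) 0 0

/-- Every affine segment of `U`, in either direction, can be parametrized as a geodesic. -/
def IsProjectivelyFlat {n : ℕ} (U : Set (Space n)) (F : Space n → Space n → ℝ) : Prop :=
  ∀ p q : Space n, p ≠ q → segment ℝ p q ⊆ U →
    ∃ (a b : ℝ) (β : ℝ → Space n), a < b ∧ IsGeodesic U F a b β ∧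
      BijOn β (Icc a b) (segment ℝ p q) ∧ β a = p ∧ β b = q

/-! ### Flag curvature -/

/-- The formal Christoffel symbols
`γᵏ_ij = ½ gᵏᵐ (∂g_im/∂xʲ + ∂g_jm/∂xⁱ - ∂g_ij/∂xᵐ)`. -/
noncomputable def formalChristoffel {n : ℕ} (F : Space n → Space n → ℝ) (k i j : Fin n)
    (x y : Space n) : ℝ :=
  (1 / 2 : ℝ) * ∑ m, (fundamentalTensor F x y)⁻¹ k m *
    (partialX j (fun z v => fundamentalTensor F z v i m) x y
      + partialX i (fun z v => fundamentalTensor F z v j m) x y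
      - partialX m (fun z v => fundamentalTensor F z v i j) x y)

/-- The spray coefficients `Gᵏ = ½ γᵏ_ij yⁱ yʲ`. -/
noncomputable def sprayCoeff {n : ℕ} (F : Space n → Space n → ℝ) (k : Fin n) (x y : Space n) : ℝ :=
  (1 / 2 : ℝ) * ∑ i, ∑ j, formalChristoffel F k i j x y * y i * y j

/-- The components of the Riemann curvature `R_y`,
`Rⁱ_k = 2 ∂Gⁱ/∂xᵏ - yʲ ∂²Gⁱ/∂xʲ∂yᵏ + 2 Gʲ ∂²Gⁱ/∂yʲ∂yᵏ - ∂Gⁱ/∂yʲ ∂Gʲ/∂yᵏ`. -/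
noncomputable def riemannCurvature {n : ℕ} (F : Space n → Space n → ℝ) (x y : Space n) :
    Matrix (Fin n) (Fin n) ℝ :=
  Matrix.of fun i k =>
    2 * partialX k (sprayCoeff F i) x y
      - ∑ j, partialX j (partialY k (sprayCoeff F i)) x y * y j
      + 2 * ∑ j, sprayCoeff F j x y * partialY j (partialY k (sprayCoeff F i)) x y
      - ∑ j, partialY j (sprayCoeff F i) x y * partialY k (sprayCoeff F j) x y

/-- The pairing `g_y (u, v) = g_ij (x, y) uⁱ vʲ`. -/
noncomputable def fundamentalForm {n : ℕ} (F : Space n → Space n → ℝ) (x y u v : Space n) : ℝ :=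
  ∑ i, ∑ j, fundamentalTensor F x y i j * u i * v j

/-- The flag curvature at `x` of the flag with flagpole `y` and plane `span {y, w}`:
`K = g_y (R_y w, w) / (F² g_y (w, w) - g_y (w, y)²)`. -/
noncomputable def flagCurvature {n : ℕ} (F : Space n → Space n → ℝ) (x y w : Space n) : ℝ :=
  fundamentalForm F x y (WithLp.toLp 2 fun i => ∑ k, riemannCurvature F x y i k * w k) w /
    (F x y ^ 2 * fundamentalForm F x y w w - fundamentalForm F x y w y ^ 2)

/-- The flag curvature of `F` on `U` is equal to the constant `κ`, for every flag. -/
def HasConstantFlagCurvature {n : ℕ} (U : Set (Space n)) (F : Space n → Space n → ℝ) (κ : ℝ) :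
    Prop :=
  ∀ x ∈ U, ∀ y w : Space n, LinearIndependent ℝ ![y, w] → flagCurvature F x y w = κ

/-! ### The Hilbert metric -/

/-- The tautological (Funk) Lagrangian `F_f (x, ξ) = inf {t > 0 | x + ξ / t ∈ U}`. -/
noncomputable def funkMetric {n : ℕ} (U : Set (Space n)) (x ξ : Space n) : ℝ :=
  sInf {t : ℝ | 0 < t ∧ x + t⁻¹ • ξ ∈ U}

/-- The Hilbert metric, `F_h (x, ξ) = ½ (F_f (x, ξ) + F_f (x, -ξ))`. -/
noncomputable def hilbertMetric {n : ℕ} (U : Set (Space n)) (x ξ : Space n) : ℝ :=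
  (1 / 2 : ℝ) * (funkMetric U x ξ + funkMetric U x (-ξ))

end Finsler

namespace Finsler

open Set Filter Topology
open scoped ContDiff

section

variable {n : ℕ} {U : Set (Space n)} {f g : Space n → Space n → ℝ} {x y : Space n}

/-! ### Calculus on the slit tangent bundle -/

/-! The link between the two sides is a spray of the form `G^k = P y^k`, the form it takes when
straight lines are geodesics up to parametrization. Write `L = F²`. The form follows from `y^j
L_{x^j y^m} - L_{x^m} = 2 P L_{y^m}` (`sprayCoeff_eq_mul`), and then the Riemann curvature is `(P² -
y^j P_{x^j}) δ^i_k + τ_k y^i` (`riemannCurvature_of_sprayCoeff_eq`). In dimension at least two,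
curvature `-1` therefore forces `y^j P_{x^j} = P² + F²`.

From Hilbert to the three properties. Let `A (x, y)` be the Funk metric and `B (x, y) = A (x, -y)`,
so that `F = (A + B) / 2`. Moving the base point while the tip of the vector stays fixed on the
boundary gives `A_{x^k} = A A_{y^k}` and `B_{x^k} = -B B_{y^k}`. These equations yield the spray
with `P = (A - B) / 2` and the curvature by pure algebra. They need `A` to be smooth, while only `F`
is assumed so; but `A` is explicit on each line, whence `y^j F_{x^j} = F (A - B)`, and `A` is
recovered from `F` and its first derivatives (`isSmoothOffZero_funkMetric`). Segments become
geodesics by solving `β'' = -2 P β'` explicitly. Completeness follows from the Lipschitz function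
`log (c - f)` attached to a supporting functional `f < c` of `U`.

From the three properties to Hilbert. The first variation along segments gives the spray, with `P =
y^j L_{x^j} / (4 L)` (`sprayDefect_of_isProjectivelyFlat`). On a line put `f t = F (x + t y, y)` and
`p t = P (x + t y, y)`. Then `f' = 2 p f` and `p' = p² + f²`, so `f t = f 0 / ((1 - (f 0 + p 0) t)
(1 + (f 0 - p 0) t))` (`mul_mul_eq_of_hasDerivAt`). A bounded `f` would let the line reach the
boundary with finite length, against completeness. So the poles sit at the two boundary points, `f 0
+ p 0 = A` and `f 0 - p 0 = B` (`eq_of_not_bounded`), and half the sum is the Hilbert metric. -/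

/-- `f (x, y)` is smooth for `x ∈ U`, `y ≠ 0`. -/
def IsSmoothOffZero (U : Set (Space n)) (f : Space n → Space n → ℝ) : Prop :=
  ContDiffOn ℝ ∞ (fun p : Space n × Space n => f p.1 p.2) (U ×ˢ {0}ᶜ)

theorem isOpen_slit (hU : IsOpen U) : IsOpen (U ×ˢ ({0}ᶜ : Set (Space n))) :=
  hU.prod isOpen_compl_singleton

theorem slit_mem_nhds (hU : IsOpen U) (hx : x ∈ U) (hy : y ≠ 0) :
    U ×ˢ ({0}ᶜ : Set (Space n)) ∈ 𝓝 (x, y) :=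
  (isOpen_slit hU).mem_nhds ⟨hx, hy⟩

theorem sum_smul_basisVec (v : Space n) : ∑ i, v i • (basisVec i : Space n) = v := by
  have := (EuclideanSpace.basisFun (Fin n) ℝ).sum_repr v
  simpa [basisVec] using this

namespace IsSmoothOffZero

theorem contDiffAt (hf : IsSmoothOffZero U f) (hU : IsOpen U) (hx : x ∈ U) (hy : y ≠ 0) :
    ContDiffAt ℝ ∞ (fun p : Space n × Space n => f p.1 p.2) (x, y) :=
  ContDiffOn.contDiffAt hf (slit_mem_nhds hU hx hy)

theorem differentiableAt (hf : IsSmoothOffZero U f) (hU : IsOpen U) (hx : x ∈ U) (hy : y ≠ 0) :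
    DifferentiableAt ℝ (fun p : Space n × Space n => f p.1 p.2) (x, y) :=
  (hf.contDiffAt hU hx hy).differentiableAt (by simp)

theorem differentiableAt_fst (hf : IsSmoothOffZero U f) (hU : IsOpen U) (hx : x ∈ U)
    (hy : y ≠ 0) : DifferentiableAt ℝ (fun z => f z y) x :=
  ((hf.differentiableAt hU hx hy).hasFDerivAt.comp (f := fun z => (z, y)) x
    (hasFDerivAt_prodMk_left (𝕜 := ℝ) x y)).differentiableAt

theorem differentiableAt_snd (hf : IsSmoothOffZero U f) (hU : IsOpen U) (hx : x ∈ U)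
    (hy : y ≠ 0) : DifferentiableAt ℝ (fun v => f x v) y :=
  ((hf.differentiableAt hU hx hy).hasFDerivAt.comp (f := fun v => (x, v)) y
    (hasFDerivAt_prodMk_right (𝕜 := ℝ) x y)).differentiableAt

theorem fderiv_basisVec_zero (hf : IsSmoothOffZero U f) (hU : IsOpen U) (hx : x ∈ U)
    (hy : y ≠ 0) (i : Fin n) :
    fderiv ℝ (fun p : Space n × Space n => f p.1 p.2) (x, y) (basisVec i, 0) =
      partialX i f x y := by
  have := ((hf.differentiableAt hU hx hy).hasFDerivAt.comp x
    (hasFDerivAt_prodMk_left (𝕜 := ℝ) x y)).fderiv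
  have h2 : partialX i f x y = fderiv ℝ (fun z => f z y) x (basisVec i) := rfl
  rw [h2]
  erw [this]
  simp

theorem fderiv_zero_basisVec (hf : IsSmoothOffZero U f) (hU : IsOpen U) (hx : x ∈ U)
    (hy : y ≠ 0) (i : Fin n) :
    fderiv ℝ (fun p : Space n × Space n => f p.1 p.2) (x, y) (0, basisVec i) =
      partialY i f x y := by
  have := ((hf.differentiableAt hU hx hy).hasFDerivAt.comp y
    (hasFDerivAt_prodMk_right (𝕜 := ℝ) x y)).fderiv
  have h2 : partialY i f x y = fderiv ℝ (fun z => f x z) y (basisVec i) := rfl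
  rw [h2]
  erw [this]
  simp

theorem fderiv_apply (hf : IsSmoothOffZero U f) (hU : IsOpen U) (hx : x ∈ U)
    (hy : y ≠ 0) (u v : Space n) :
    fderiv ℝ (fun p : Space n × Space n => f p.1 p.2) (x, y) (u, v) =
      ∑ i, u i * partialX i f x y + ∑ i, v i * partialY i f x y := by
  have hu : (u, v) = (∑ i, u i • ((basisVec i : Space n), (0 : Space n))) +
      ∑ i, v i • ((0 : Space n), (basisVec i : Space n)) := by
    refine Prod.ext ?_ ?_
    · simp [Prod.fst_sum, sum_smul_basisVec]
    · simp [Prod.snd_sum, sum_smul_basisVec]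
  rw [hu, map_add, map_sum, map_sum]
  simp only [map_smul, smul_eq_mul, hf.fderiv_basisVec_zero hU hx hy,
    hf.fderiv_zero_basisVec hU hx hy]

/-- Chain rule along a curve in the slit tangent bundle. -/
theorem hasDerivAt_comp (hf : IsSmoothOffZero U f) (hU : IsOpen U) {β γ : ℝ → Space n}
    {β' γ' : Space n} {s : ℝ} (hβ : HasDerivAt β β' s) (hγ : HasDerivAt γ γ' s)
    (hx : β s ∈ U) (hy : γ s ≠ 0) :
    HasDerivAt (fun t => f (β t) (γ t))
      (∑ i, β' i * partialX i f (β s) (γ s) + ∑ i, γ' i * partialY i f (β s) (γ s)) s := by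
  rw [← hf.fderiv_apply hU hx hy]
  exact (hf.differentiableAt hU hx hy).hasFDerivAt.comp_hasDerivAt (f := fun t => (β t, γ t)) s
    (hβ.prodMk hγ)

theorem hasDerivAt_line (hf : IsSmoothOffZero U f) (hU : IsOpen U) {t : ℝ} {v : Space n}
    (hx : x + t • v ∈ U) (hy : y ≠ 0) :
    HasDerivAt (fun t => f (x + t • v) y) (∑ i, v i * partialX i f (x + t • v) y) t := by
  have h1 : HasDerivAt (fun t : ℝ => x + t • v) v t := by
    simpa using ((hasDerivAt_id t).smul_const v).const_add x
  simpa using hf.hasDerivAt_comp hU h1 (hasDerivAt_const t y) hx hy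

theorem congr (hf : IsSmoothOffZero U f) (h : ∀ x ∈ U, ∀ y, y ≠ 0 → g x y = f x y) :
    IsSmoothOffZero U g :=
  ContDiffOn.congr hf fun p hp => h p.1 hp.1 p.2 hp.2

theorem add (hf : IsSmoothOffZero U f) (hg : IsSmoothOffZero U g) :
    IsSmoothOffZero U (fun x y => f x y + g x y) := ContDiffOn.add hf hg

theorem sub (hf : IsSmoothOffZero U f) (hg : IsSmoothOffZero U g) :
    IsSmoothOffZero U (fun x y => f x y - g x y) := ContDiffOn.sub hf hg

theorem mul (hf : IsSmoothOffZero U f) (hg : IsSmoothOffZero U g) :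
    IsSmoothOffZero U (fun x y => f x y * g x y) := ContDiffOn.mul hf hg

theorem pow (hf : IsSmoothOffZero U f) (k : ℕ) :
    IsSmoothOffZero U (fun x y => f x y ^ k) := ContDiffOn.pow hf k

theorem const_mul (hf : IsSmoothOffZero U f) (c : ℝ) :
    IsSmoothOffZero U (fun x y => c * f x y) := ContDiffOn.mul contDiffOn_const hf

theorem div (hf : IsSmoothOffZero U f) (hg : IsSmoothOffZero U g)
    (h0 : ∀ x ∈ U, ∀ y, y ≠ 0 → g x y ≠ 0) :
    IsSmoothOffZero U (fun x y => f x y / g x y) :=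
  ContDiffOn.div hf hg fun p hp => h0 p.1 hp.1 p.2 hp.2

theorem sum {ι : Type*} {s : Finset ι} {f : ι → Space n → Space n → ℝ}
    (hf : ∀ i ∈ s, IsSmoothOffZero U (f i)) :
    IsSmoothOffZero U (fun x y => ∑ i ∈ s, f i x y) := ContDiffOn.sum hf

theorem coord (U : Set (Space n)) (i : Fin n) : IsSmoothOffZero U (fun _ y => y i) := by
  have : ContDiff ℝ ∞ (fun p : Space n × Space n => p.2 i) :=
    (EuclideanSpace.proj (𝕜 := ℝ) i).contDiff.comp contDiff_snd
  exact this.contDiffOn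

theorem fderiv_apply_const (hf : IsSmoothOffZero U f) (hU : IsOpen U)
    (w : Space n × Space n) :
    ContDiffOn ℝ ∞ (fun p : Space n × Space n =>
      fderiv ℝ (fun p : Space n × Space n => f p.1 p.2) p w) (U ×ˢ {0}ᶜ) :=
  (ContDiffOn.fderiv_of_isOpen hf (isOpen_slit hU) (by simp)).clm_apply contDiffOn_const

theorem partialX (hf : IsSmoothOffZero U f) (hU : IsOpen U) (i : Fin n) :
    IsSmoothOffZero U (partialX i f) :=
  (hf.fderiv_apply_const hU (basisVec i, 0)).congr fun _ hp =>
    (hf.fderiv_basisVec_zero hU hp.1 hp.2 i).symm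

theorem partialY (hf : IsSmoothOffZero U f) (hU : IsOpen U) (i : Fin n) :
    IsSmoothOffZero U (partialY i f) :=
  (hf.fderiv_apply_const hU (0, basisVec i)).congr fun _ hp =>
    (hf.fderiv_zero_basisVec hU hp.1 hp.2 i).symm

theorem continuousAt_fst (hf : IsSmoothOffZero U f) (hU : IsOpen U) (hx : x ∈ U)
    (hy : y ≠ 0) : ContinuousAt (fun z => f z y) x :=
  (hf.differentiableAt_fst hU hx hy).continuousAt

end IsSmoothOffZero

/-! ### Rules for partial derivatives and their commutation -/

section partials

variable (hU : IsOpen U) (hx : x ∈ U) (hy : y ≠ 0)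
include hU hx hy

theorem partialX_congr (h : ∀ x ∈ U, ∀ y, y ≠ 0 → f x y = g x y) (i : Fin n) :
    partialX i f x y = partialX i g x y := by
  have : (fun z => f z y) =ᶠ[𝓝 x] fun z => g z y := by
    filter_upwards [hU.mem_nhds hx] with z hz using h z hz y hy
  simp only [partialX, this.fderiv_eq]

omit hU in
theorem partialY_congr (h : ∀ x ∈ U, ∀ y, y ≠ 0 → f x y = g x y) (i : Fin n) :
    partialY i f x y = partialY i g x y := by
  have : (fun z => f x z) =ᶠ[𝓝 y] fun z => g x z := by
    filter_upwards [isOpen_compl_singleton.mem_nhds hy] with z hz using h x hx z hz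
  simp only [partialY, this.fderiv_eq]

theorem partialX_add (hf : IsSmoothOffZero U f) (hg : IsSmoothOffZero U g) (i : Fin n) :
    partialX i (fun x y => f x y + g x y) x y = partialX i f x y + partialX i g x y := by
  simp only [partialX]
  rw [fderiv_fun_add (hf.differentiableAt_fst hU hx hy) (hg.differentiableAt_fst hU hx hy)]
  simp

theorem partialY_add (hf : IsSmoothOffZero U f) (hg : IsSmoothOffZero U g) (i : Fin n) :
    partialY i (fun x y => f x y + g x y) x y = partialY i f x y + partialY i g x y := by
  simp only [partialY]
  rw [fderiv_fun_add (hf.differentiableAt_snd hU hx hy) (hg.differentiableAt_snd hU hx hy)]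
  simp

theorem partialX_sub (hf : IsSmoothOffZero U f) (hg : IsSmoothOffZero U g) (i : Fin n) :
    partialX i (fun x y => f x y - g x y) x y = partialX i f x y - partialX i g x y := by
  simp only [partialX]
  rw [fderiv_fun_sub (hf.differentiableAt_fst hU hx hy) (hg.differentiableAt_fst hU hx hy)]
  simp

theorem partialY_sub (hf : IsSmoothOffZero U f) (hg : IsSmoothOffZero U g) (i : Fin n) :
    partialY i (fun x y => f x y - g x y) x y = partialY i f x y - partialY i g x y := by
  simp only [partialY]
  rw [fderiv_fun_sub (hf.differentiableAt_snd hU hx hy) (hg.differentiableAt_snd hU hx hy)]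
  simp

theorem partialX_mul (hf : IsSmoothOffZero U f) (hg : IsSmoothOffZero U g) (i : Fin n) :
    partialX i (fun x y => f x y * g x y) x y =
      f x y * partialX i g x y + partialX i f x y * g x y := by
  simp only [partialX]
  rw [fderiv_fun_mul (hf.differentiableAt_fst hU hx hy) (hg.differentiableAt_fst hU hx hy)]
  simp [mul_comm]

theorem partialY_mul (hf : IsSmoothOffZero U f) (hg : IsSmoothOffZero U g) (i : Fin n) :
    partialY i (fun x y => f x y * g x y) x y =
      f x y * partialY i g x y + partialY i f x y * g x y := by
  simp only [partialY]
  rw [fderiv_fun_mul (hf.differentiableAt_snd hU hx hy) (hg.differentiableAt_snd hU hx hy)]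
  simp [mul_comm]

theorem partialX_sq (hf : IsSmoothOffZero U f) (i : Fin n) :
    partialX i (fun x y => f x y ^ 2) x y = 2 * f x y * partialX i f x y := by
  simp only [sq]
  rw [partialX_mul hU hx hy hf hf]
  ring

theorem partialY_sq (hf : IsSmoothOffZero U f) (i : Fin n) :
    partialY i (fun x y => f x y ^ 2) x y = 2 * f x y * partialY i f x y := by
  simp only [sq]
  rw [partialY_mul hU hx hy hf hf]
  ring

theorem partialX_const_mul (hf : IsSmoothOffZero U f) (c : ℝ) (i : Fin n) :
    partialX i (fun x y => c * f x y) x y = c * partialX i f x y := by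
  simp only [partialX]
  rw [fderiv_const_mul (hf.differentiableAt_fst hU hx hy)]
  simp

theorem partialY_const_mul (hf : IsSmoothOffZero U f) (c : ℝ) (i : Fin n) :
    partialY i (fun x y => c * f x y) x y = c * partialY i f x y := by
  simp only [partialY]
  rw [fderiv_const_mul (hf.differentiableAt_snd hU hx hy)]
  simp

theorem partialX_sum {ι : Type*} {s : Finset ι} {f : ι → Space n → Space n → ℝ}
    (hf : ∀ i ∈ s, IsSmoothOffZero U (f i)) (k : Fin n) :
    partialX k (fun x y => ∑ i ∈ s, f i x y) x y = ∑ i ∈ s, partialX k (f i) x y := by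
  simp only [partialX]
  rw [fderiv_fun_sum fun i hi => (hf i hi).differentiableAt_fst hU hx hy]
  simp

theorem fderiv_fderiv_apply (hf : IsSmoothOffZero U f) (v w : Space n × Space n) :
    fderiv ℝ (fun p => fderiv ℝ (fun p : Space n × Space n => f p.1 p.2) p w) (x, y) v =
      fderiv ℝ (fun p => fderiv ℝ (fun p : Space n × Space n => f p.1 p.2) p v) (x, y) w := by
  have hd : DifferentiableAt ℝ (fderiv ℝ (fun p : Space n × Space n => f p.1 p.2)) (x, y) :=
    ((hf.contDiffAt hU hx hy).fderiv_right (m := ∞) (by simp)).differentiableAt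
      (by simp)
  have hs := (hf.contDiffAt hU hx hy).isSymmSndFDerivAt (by
    simpa using WithTop.coe_le_coe.2 (le_top : (2 : ℕ∞) ≤ ⊤))
  have h1 : ∀ u, fderiv ℝ (fun p => fderiv ℝ (fun p : Space n × Space n => f p.1 p.2) p u) (x, y)
      = (fderiv ℝ (fderiv ℝ (fun p : Space n × Space n => f p.1 p.2)) (x, y)).flip u := by
    intro u
    rw [fderiv_clm_apply hd (differentiableAt_const u)]
    simp
  rw [h1, h1]
  exact hs v w

/-- Only values on the open slit bundle matter, so a partial derivative may be replaced by the total
differential evaluated in a fixed direction. This puts mixed partials within reach of the symmetry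
of the second derivative. -/
theorem partialX_eq_fderiv_of_eqOn (hg : IsSmoothOffZero U g) {h : Space n × Space n → ℝ}
    (hh : ∀ x ∈ U, ∀ y, y ≠ 0 → h (x, y) = g x y) (i : Fin n) :
    partialX i g x y = fderiv ℝ h (x, y) (basisVec i, 0) := by
  rw [← hg.fderiv_basisVec_zero hU hx hy]
  congr 1
  refine Filter.EventuallyEq.fderiv_eq ?_
  filter_upwards [slit_mem_nhds hU hx hy] with p hp using (hh p.1 hp.1 p.2 hp.2).symm

theorem partialY_eq_fderiv_of_eqOn (hg : IsSmoothOffZero U g) {h : Space n × Space n → ℝ}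
    (hh : ∀ x ∈ U, ∀ y, y ≠ 0 → h (x, y) = g x y) (i : Fin n) :
    partialY i g x y = fderiv ℝ h (x, y) (0, basisVec i) := by
  rw [← hg.fderiv_zero_basisVec hU hx hy]
  congr 1
  refine Filter.EventuallyEq.fderiv_eq ?_
  filter_upwards [slit_mem_nhds hU hx hy] with p hp using (hh p.1 hp.1 p.2 hp.2).symm

theorem partialX_partialY_comm (hf : IsSmoothOffZero U f) (i j : Fin n) :
    partialX i (partialY j f) x y = partialY j (partialX i f) x y := by
  rw [partialX_eq_fderiv_of_eqOn hU hx hy (hf.partialY hU j)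
      (h := fun p => fderiv ℝ (fun p : Space n × Space n => f p.1 p.2) p (0, basisVec j))
      (fun _ hx _ hy => hf.fderiv_zero_basisVec hU hx hy j) i,
    partialY_eq_fderiv_of_eqOn hU hx hy (hf.partialX hU i)
      (h := fun p => fderiv ℝ (fun p : Space n × Space n => f p.1 p.2) p (basisVec i, 0))
      (fun _ hx _ hy => hf.fderiv_basisVec_zero hU hx hy i) j,
    fderiv_fderiv_apply hU hx hy hf]

theorem partialY_partialY_comm (hf : IsSmoothOffZero U f) (i j : Fin n) :
    partialY i (partialY j f) x y = partialY j (partialY i f) x y := by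
  rw [partialY_eq_fderiv_of_eqOn hU hx hy (hf.partialY hU j)
      (h := fun p => fderiv ℝ (fun p : Space n × Space n => f p.1 p.2) p (0, basisVec j))
      (fun _ hx _ hy => hf.fderiv_zero_basisVec hU hx hy j) i,
    partialY_eq_fderiv_of_eqOn hU hx hy (hf.partialY hU i)
      (h := fun p => fderiv ℝ (fun p : Space n × Space n => f p.1 p.2) p (0, basisVec i))
      (fun _ hx _ hy => hf.fderiv_zero_basisVec hU hx hy i) j,
    fderiv_fderiv_apply hU hx hy hf]

end partials

theorem partialX_coord (i k : Fin n) : partialX i (fun _ y : Space n => y k) x y = 0 := by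
  simp [partialX]

theorem partialY_coord (i k : Fin n) :
    partialY i (fun _ y : Space n => y k) x y = if k = i then 1 else 0 := by
  have : fderiv ℝ (fun v : Space n => v k) y = EuclideanSpace.proj (𝕜 := ℝ) k :=
    (EuclideanSpace.proj (𝕜 := ℝ) k).hasFDerivAt.fderiv
  simp only [partialY, this]
  simp [basisVec]

/-! ### Positive homogeneity -/

/-- `f (x, y)` is positively homogeneous of degree `k` in `y ≠ 0`, for `x ∈ U`. -/
def IsHomogeneousOfDegree (U : Set (Space n)) (k : ℕ) (f : Space n → Space n → ℝ) : Prop :=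
  ∀ x ∈ U, ∀ y, y ≠ 0 → ∀ c : ℝ, 0 < c → f x (c • y) = c ^ k * f x y

namespace IsHomogeneousOfDegree

variable {k : ℕ}

theorem euler (hf : IsHomogeneousOfDegree U k f) (hs : IsSmoothOffZero U f) (hU : IsOpen U)
    (hx : x ∈ U) (hy : y ≠ 0) : ∑ i, y i * Finsler.partialY i f x y = k * f x y := by
  have hc : HasDerivAt (fun t : ℝ => t • y) y 1 := by
    simpa using (hasDerivAt_id (1 : ℝ)).smul_const y
  have h1 := hs.hasDerivAt_comp hU (hasDerivAt_const (1 : ℝ) x) hc hx (by simpa using hy)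
  have h2 : HasDerivAt (fun t : ℝ => f x (t • y)) (k * f x y) 1 := by
    have : HasDerivAt (fun t : ℝ => t ^ k * f x y) (k * f x y) 1 := by
      simpa using (hasDerivAt_pow k (1 : ℝ)).mul_const (f x y)
    refine this.congr_of_eventuallyEq ?_
    filter_upwards [lt_mem_nhds (zero_lt_one (α := ℝ))] with t ht using hf x hx y hy t ht
  simpa using h1.unique h2

theorem partialX (hf : IsHomogeneousOfDegree U k f) (hs : IsSmoothOffZero U f)
    (hU : IsOpen U) (i : Fin n) : IsHomogeneousOfDegree U k (partialX i f) := by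
  intro x hx y hy c hc
  have : (fun z => f z (c • y)) =ᶠ[𝓝 x] fun z => c ^ k * f z y := by
    filter_upwards [hU.mem_nhds hx] with z hz using hf z hz y hy c hc
  simp only [Finsler.partialX]
  rw [this.fderiv_eq, fderiv_const_mul (hs.differentiableAt_fst hU hx hy)]
  simp

theorem partialY (hf : IsHomogeneousOfDegree U (k + 1) f) (hs : IsSmoothOffZero U f)
    (hU : IsOpen U) (i : Fin n) : IsHomogeneousOfDegree U k (partialY i f) := by
  intro x hx y hy c hc
  have hcy : c • y ≠ 0 := smul_ne_zero hc.ne' hy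
  have : (fun z => f x (c • z)) =ᶠ[𝓝 y] fun z => c ^ (k + 1) * f x z := by
    filter_upwards [isOpen_compl_singleton.mem_nhds hy] with z hz using hf x hx z hz c hc
  have h1 := this.fderiv_eq (𝕜 := ℝ)
  rw [fderiv_const_mul (hs.differentiableAt_snd hU hx hy)] at h1
  have h2 : HasFDerivAt (fun z => f x (c • z))
      ((fderiv ℝ (fun v => f x v) (c • y)).comp (c • ContinuousLinearMap.id ℝ (Space n))) y :=
    (hs.differentiableAt_snd hU hx hcy).hasFDerivAt.comp y ((hasFDerivAt_id y).const_smul c)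
  rw [h2.fderiv] at h1
  have h3 := congrArg (fun T => T (basisVec i)) h1
  simp only [ContinuousLinearMap.comp_apply, _root_.smul_apply,
    ContinuousLinearMap.id_apply, map_smul, smul_eq_mul] at h3
  simp only [Finsler.partialY]
  refine mul_left_cancel₀ hc.ne' ?_
  rw [h3]
  ring

end IsHomogeneousOfDegree

end

section

variable {n : ℕ} {U : Set (Space n)} {F P : Space n → Space n → ℝ} {x y : Space n}

/-! ### The spray of a metric whose geodesics are straight -/

/-- The Lagrangian `F²`. -/
def lagrangian (F : Space n → Space n → ℝ) : Space n → Space n → ℝ := fun z v => F z v ^ 2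

/-- `y^j ∂²F²/∂x^j∂y^m - ∂F²/∂x^m`, which is `4 g_mk G^k`. -/
noncomputable def sprayDefect (F : Space n → Space n → ℝ) (m : Fin n) (x y : Space n) : ℝ :=
  ∑ j, y j * partialX j (partialY m (lagrangian F)) x y - partialX m (lagrangian F) x y

namespace IsStronglyConvex

variable (hF : IsStronglyConvex U F)
include hF

theorem isSmoothOffZero : IsSmoothOffZero U F := hF.smooth

theorem isSmoothOffZero_lagrangian : IsSmoothOffZero U (lagrangian F) :=
  hF.isSmoothOffZero.pow 2

theorem isHomogeneous : IsHomogeneousOfDegree U 1 F := fun x hx y _ c hc => by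
  rw [hF.smul x hx c hc.le y, pow_one]

theorem isHomogeneous_lagrangian : IsHomogeneousOfDegree U 2 (lagrangian F) :=
  fun x hx y hy c hc => by
    simp only [lagrangian, hF.isHomogeneous x hx y hy c hc]
    ring

variable (hU : IsOpen U)

include hU

theorem isHomogeneous_partialY_lagrangian (m : Fin n) :
    IsHomogeneousOfDegree U 1 (partialY m (lagrangian F)) :=
  hF.isHomogeneous_lagrangian.partialY hF.isSmoothOffZero_lagrangian hU m

theorem isSmoothOffZero_fundamentalTensor (i j : Fin n) :
    IsSmoothOffZero U (fun x y => fundamentalTensor F x y i j) :=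
  ((hF.isSmoothOffZero_lagrangian.partialY hU j).partialY hU i).const_mul _

variable (hx : x ∈ U) (hy : y ≠ 0)
include hx hy

theorem sum_mul_partialY_lagrangian :
    ∑ m, y m * partialY m (lagrangian F) x y = 2 * F x y ^ 2 := by
  rw [hF.isHomogeneous_lagrangian.euler hF.isSmoothOffZero_lagrangian hU hx hy]
  rfl

theorem partialY_lagrangian (m : Fin n) :
    partialY m (lagrangian F) x y = 2 * F x y * partialY m F x y :=
  partialY_sq hU hx hy hF.isSmoothOffZero m

theorem partialX_lagrangian (m : Fin n) :
    partialX m (lagrangian F) x y = 2 * F x y * partialX m F x y :=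
  partialX_sq hU hx hy hF.isSmoothOffZero m

theorem fundamentalTensor_symm (i j : Fin n) :
    fundamentalTensor F x y i j = fundamentalTensor F x y j i := by
  have := partialY_partialY_comm hU hx hy hF.isSmoothOffZero_lagrangian i j
  simp only [fundamentalTensor, Matrix.of_apply]
  exact congrArg _ this

/-- Euler's relation for the degree one function `L_{y^m}`. -/
theorem sum_mul_fundamentalTensor (m : Fin n) :
    ∑ i, y i * fundamentalTensor F x y i m = 1 / 2 * partialY m (lagrangian F) x y := by
  have := (hF.isHomogeneous_partialY_lagrangian hU m).euler
    (hF.isSmoothOffZero_lagrangian.partialY hU m) hU hx hy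
  simp only [Nat.cast_one, one_mul] at this
  rw [← this, Finset.mul_sum]
  refine Finset.sum_congr rfl fun i _ => ?_
  have : fundamentalTensor F x y i m = 1 / 2 * partialY i (partialY m (lagrangian F)) x y := rfl
  rw [this]
  ring

theorem sum_sum_mul_fundamentalTensor :
    ∑ i, ∑ j, y i * y j * fundamentalTensor F x y i j = lagrangian F x y := by
  rw [Finset.sum_comm]
  have h : ∀ j, ∑ i, y i * y j * fundamentalTensor F x y i j
      = 1 / 2 * (y j * partialY j (lagrangian F) x y) := by
    intro j
    have := hF.sum_mul_fundamentalTensor hU hx hy j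
    calc _ = y j * ∑ i, y i * fundamentalTensor F x y i j := by
          rw [Finset.mul_sum]
          exact Finset.sum_congr rfl fun i _ => by ring
      _ = _ := by rw [this]; ring
  rw [Finset.sum_congr rfl fun j _ => h j, ← Finset.mul_sum,
    hF.sum_mul_partialY_lagrangian hU hx hy, lagrangian]
  ring

/-- The relation `sum_mul_fundamentalTensor` is differentiated in `x`, where the coefficients `y^i`
are constant. -/
theorem sum_mul_partialX_fundamentalTensor (j m : Fin n) :
    ∑ i, y i * partialX j (fun z v => fundamentalTensor F z v i m) x y =
      1 / 2 * partialX j (partialY m (lagrangian F)) x y := by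
  have hs := fun i => hF.isSmoothOffZero_fundamentalTensor hU i m
  have h := partialX_congr hU hx hy
    (fun x hx y hy => hF.sum_mul_fundamentalTensor hU (x := x) (y := y) hx hy m) j
  rw [partialX_const_mul hU hx hy (hF.isSmoothOffZero_lagrangian.partialY hU m),
    partialX_sum hU hx hy (fun i _ => (IsSmoothOffZero.coord U i).mul (hs i))] at h
  rw [← h]
  refine Finset.sum_congr rfl fun i _ => ?_
  rw [partialX_mul hU hx hy (IsSmoothOffZero.coord U i) (hs i), partialX_coord]
  ring

theorem sum_sum_mul_partialX_fundamentalTensor (m : Fin n) :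
    ∑ i, ∑ j, y i * y j * partialX m (fun z v => fundamentalTensor F z v i j) x y =
      partialX m (lagrangian F) x y := by
  have hs := fun i j => hF.isSmoothOffZero_fundamentalTensor hU i j
  have hc := IsSmoothOffZero.coord U
  have h := partialX_congr hU hx hy
    (fun x hx y hy => hF.sum_sum_mul_fundamentalTensor hU (x := x) (y := y) hx hy) m
  rw [partialX_sum hU hx hy (fun i _ => IsSmoothOffZero.sum
    fun j _ => ((hc i).mul (hc j)).mul (hs i j))] at h
  rw [← h]
  refine Finset.sum_congr rfl fun i _ => ?_
  rw [partialX_sum hU hx hy (fun j _ => ((hc i).mul (hc j)).mul (hs i j))]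
  refine Finset.sum_congr rfl fun j _ => ?_
  rw [partialX_mul hU hx hy ((hc i).mul (hc j)) (hs i j),
    partialX_mul hU hx hy (hc i) (hc j), partialX_coord, partialX_coord]
  ring

/-- Contracted with `y^i y^j`, the first two Christoffel terms agree after exchanging `i` and `j`,
each giving half of `y^j L_{x^j y^m}`; the third gives `L_{x^m}`. All third derivatives of `L`
disappear. -/
theorem sprayCoeff_eq (k : Fin n) :
    sprayCoeff F k x y =
      1 / 4 * ∑ m, (fundamentalTensor F x y)⁻¹ k m * sprayDefect F m x y := by
  have h1 : ∀ m, ∑ i, ∑ j, y i * y j * (partialX j (fun z v => fundamentalTensor F z v i m) x y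
      + partialX i (fun z v => fundamentalTensor F z v j m) x y
      - partialX m (fun z v => fundamentalTensor F z v i j) x y) = sprayDefect F m x y := by
    intro m
    have e1 : ∑ i, ∑ j, y i * y j * partialX j (fun z v => fundamentalTensor F z v i m) x y =
        ∑ j, 1 / 2 * (y j * partialX j (partialY m (lagrangian F)) x y) := by
      rw [Finset.sum_comm]
      refine Finset.sum_congr rfl fun j _ => ?_
      rw [mul_left_comm, ← hF.sum_mul_partialX_fundamentalTensor hU hx hy j m, Finset.mul_sum]
      exact Finset.sum_congr rfl fun i _ => by ring
    have e2 : ∑ i, ∑ j, y i * y j * partialX i (fun z v => fundamentalTensor F z v j m) x y =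
        ∑ j, 1 / 2 * (y j * partialX j (partialY m (lagrangian F)) x y) := by
      rw [← e1, Finset.sum_comm]
      exact Finset.sum_congr rfl fun i _ => Finset.sum_congr rfl fun j _ => by ring
    simp only [mul_add, mul_sub, Finset.sum_add_distrib, Finset.sum_sub_distrib]
    rw [e1, e2, hF.sum_sum_mul_partialX_fundamentalTensor hU hx hy m, sprayDefect,
      ← Finset.mul_sum]
    ring
  simp only [← h1, sprayCoeff, formalChristoffel, Finset.mul_sum, Finset.sum_mul]
  symm
  rw [Finset.sum_comm]
  refine Finset.sum_congr rfl fun i _ => ?_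
  rw [Finset.sum_comm]
  exact Finset.sum_congr rfl fun j _ => Finset.sum_congr rfl fun m _ => by ring

/-- Since `L_{y^m} = 2 g_{mi} y^i`, the defect equals `4 p g y`, and the inverse matrix in
`sprayCoeff_eq` cancels `g`. -/
theorem sprayCoeff_eq_mul {p : ℝ}
    (h : ∀ m, sprayDefect F m x y = 2 * p * partialY m (lagrangian F) x y) (k : Fin n) :
    sprayCoeff F k x y = p * y k := by
  have hdet := (Matrix.isUnit_iff_isUnit_det _).1 (hF.posDef x hx y hy).isUnit
  have h2 : ∀ m, sprayDefect F m x y =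
      4 * p * (Matrix.mulVec (fundamentalTensor F x y) y.ofLp) m := by
    intro m
    have := hF.sum_mul_fundamentalTensor hU hx hy m
    have e : (Matrix.mulVec (fundamentalTensor F x y) y.ofLp) m
        = ∑ i, y i * fundamentalTensor F x y i m := by
      simp only [Matrix.mulVec, dotProduct]
      exact Finset.sum_congr rfl fun i _ => by
        rw [hF.fundamentalTensor_symm hU hx hy, mul_comm]
    rw [e, this, h]
    ring
  rw [hF.sprayCoeff_eq hU hx hy]
  have h3 : Matrix.mulVec (fundamentalTensor F x y)⁻¹
      (Matrix.mulVec (fundamentalTensor F x y) y.ofLp) k = y k := by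
    rw [Matrix.mulVec_mulVec, Matrix.nonsing_inv_mul _ hdet, Matrix.one_mulVec]
  have h4 : ∑ m, (fundamentalTensor F x y)⁻¹ k m *
      (Matrix.mulVec (fundamentalTensor F x y) y.ofLp) m = y k := h3
  rw [← h4]
  simp only [h2, Finset.mul_sum]
  exact Finset.sum_congr rfl fun m _ => by ring

end IsStronglyConvex

/-- Riemann curvature of a spray of the form `G^k = P y^k`. -/
theorem riemannCurvature_of_sprayCoeff_eq (hU : IsOpen U) (hP : IsSmoothOffZero U P)
    (hP1 : IsHomogeneousOfDegree U 1 P)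
    (hG : ∀ x ∈ U, ∀ y, y ≠ 0 → ∀ k, sprayCoeff F k x y = P x y * y k)
    (hx : x ∈ U) (hy : y ≠ 0) (i k : Fin n) :
    riemannCurvature F x y i k =
      (P x y ^ 2 - ∑ j, y j * partialX j P x y) * (if i = k then 1 else 0) +
      (2 * partialX k P x y - ∑ j, y j * partialX j (partialY k P) x y
        - P x y * partialY k P x y) * y i := by
  have hc := IsSmoothOffZero.coord U
  have gX : ∀ k, partialX k (sprayCoeff F i) x y = partialX k P x y * y i := by
    intro k
    rw [partialX_congr hU hx hy (fun x hx y hy => hG x hx y hy i),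
      partialX_mul hU hx hy hP (hc i), partialX_coord]
    ring
  have gY : ∀ i k, ∀ x ∈ U, ∀ y, y ≠ 0 → partialY k (sprayCoeff F i) x y =
      (if i = k then 1 else 0) * P x y + partialY k P x y * y i := by
    intro i k x hx y hy
    rw [partialY_congr hx hy (fun x hx y hy => hG x hx y hy i),
      partialY_mul hU hx hy hP (hc i), partialY_coord]
    ring
  have hPk := hP.partialY hU k
  have gXY : ∀ j, partialX j (partialY k (sprayCoeff F i)) x y =
      (if i = k then 1 else 0) * partialX j P x y + partialX j (partialY k P) x y * y i := by
    intro j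
    rw [partialX_congr hU hx hy (gY i k), partialX_add hU hx hy (hP.const_mul _)
      (hPk.mul (hc i)), partialX_const_mul hU hx hy hP, partialX_mul hU hx hy hPk (hc i),
      partialX_coord]
    ring
  have gYY : ∀ j, partialY j (partialY k (sprayCoeff F i)) x y =
      (if i = k then 1 else 0) * partialY j P x y + (partialY k P x y * (if i = j then 1 else 0)
        + partialY j (partialY k P) x y * y i) := by
    intro j
    rw [partialY_congr hx hy (gY i k), partialY_add hU hx hy (hP.const_mul _)
      (hPk.mul (hc i)), partialY_const_mul hU hx hy hP, partialY_mul hU hx hy hPk (hc i),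
      partialY_coord]
  -- `P` has degree one and `P_{y^k}` degree zero, so contraction with `y` returns `P` and `0`. This
  -- removes all second `y`-derivatives from the curvature.
  have e1 := hP1.euler hP hU hx hy
  have e0 := (hP1.partialY (k := 0) hP hU k).euler hPk hU hx hy
  simp only [Nat.cast_one, one_mul, Nat.cast_zero, zero_mul] at e1 e0
  have s1 : ∑ j, partialX j (partialY k (sprayCoeff F i)) x y * y j =
      (if i = k then 1 else 0) * ∑ j, y j * partialX j P x y +
        (∑ j, y j * partialX j (partialY k P) x y) * y i := by
    simp only [gXY, Finset.mul_sum, Finset.sum_mul, ← Finset.sum_add_distrib]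
    exact Finset.sum_congr rfl fun j _ => by ring
  have s2 : ∑ j, sprayCoeff F j x y * partialY j (partialY k (sprayCoeff F i)) x y =
      P x y * ((if i = k then 1 else 0) * P x y + partialY k P x y * y i) := by
    have : ∑ j, sprayCoeff F j x y * partialY j (partialY k (sprayCoeff F i)) x y =
        P x y * ((if i = k then 1 else 0) * ∑ j, y j * partialY j P x y +
          partialY k P x y * (∑ j, if i = j then y j else 0) +
          (∑ j, y j * partialY j (partialY k P) x y) * y i) := by
      simp only [gYY, hG x hx y hy, Finset.mul_sum, Finset.sum_mul, ← Finset.sum_add_distrib]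
      exact Finset.sum_congr rfl fun j _ => by split_ifs <;> ring
    rw [this, e1, e0]
    simp
  -- The product of `δ P + P_{y^j} y^i` with itself: three of its four terms equal `P P_{y^k} y^i`.
  have s3 : ∑ j, partialY j (sprayCoeff F i) x y * partialY k (sprayCoeff F j) x y =
      3 * (P x y * partialY k P x y * y i) + P x y ^ 2 * (if i = k then 1 else 0) := by
    have : ∑ j, partialY j (sprayCoeff F i) x y * partialY k (sprayCoeff F j) x y =
        P x y ^ 2 * (∑ j, if i = j then (if j = k then 1 else 0) else 0) +
        P x y * partialY k P x y * (∑ j, if i = j then y j else 0) +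
        P x y * y i * (∑ j, if j = k then partialY j P x y else 0) +
        partialY k P x y * y i * ∑ j, y j * partialY j P x y := by
      simp only [gY _ _ x hx y hy, Finset.mul_sum, ← Finset.sum_add_distrib]
      exact Finset.sum_congr rfl fun j _ => by split_ifs <;> ring
    rw [this, e1]
    simp
    ring
  simp only [riemannCurvature, Matrix.of_apply]
  rw [gX, s1, s2, s3]
  ring

end

section

variable {n : ℕ} {U : Set (Space n)} {F P : Space n → Space n → ℝ} {x y : Space n}

/-! ### Flag curvature of a metric whose geodesics are straight -/

theorem fundamentalForm_add_left (u v w : Space n) :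
    fundamentalForm F x y (u + v) w = fundamentalForm F x y u w + fundamentalForm F x y v w := by
  simp only [fundamentalForm, ← Finset.sum_add_distrib, PiLp.add_apply]
  exact Finset.sum_congr rfl fun i _ => Finset.sum_congr rfl fun j _ => by ring

theorem fundamentalForm_smul_left (c : ℝ) (u w : Space n) :
    fundamentalForm F x y (c • u) w = c * fundamentalForm F x y u w := by
  simp only [fundamentalForm, Finset.mul_sum, PiLp.smul_apply, smul_eq_mul]
  exact Finset.sum_congr rfl fun i _ => Finset.sum_congr rfl fun j _ => by ring

/-- The curvature operator is `ξ` times the identity plus a map onto the line of the flagpole `y`.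
-/
theorem flagCurvature_eq {w : Space n} {ξ : ℝ} {τ : Fin n → ℝ}
    (hR : ∀ i k, riemannCurvature F x y i k = ξ * (if i = k then 1 else 0) + τ k * y i) :
    flagCurvature F x y w =
      (ξ * fundamentalForm F x y w w + (∑ k, τ k * w k) * fundamentalForm F x y y w) /
        (F x y ^ 2 * fundamentalForm F x y w w - fundamentalForm F x y w y ^ 2) := by
  have : (WithLp.toLp 2 fun i => ∑ k, riemannCurvature F x y i k * w k : Space n) =
      ξ • w + (∑ k, τ k * w k) • y := by
    ext i
    simp only [hR, PiLp.add_apply, PiLp.smul_apply, smul_eq_mul, add_mul, Finset.sum_add_distrib,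
      Finset.sum_mul]
    congr 1
    · simp
    · exact Finset.sum_congr rfl fun k _ => by ring
  rw [flagCurvature, this, fundamentalForm_add_left, fundamentalForm_smul_left,
    fundamentalForm_smul_left]

namespace IsStronglyConvex

variable (hF : IsStronglyConvex U F) (hx : x ∈ U) (hy : y ≠ 0)
include hF hx hy

theorem fundamentalForm_self_pos {u : Space n} (hu : u ≠ 0) : 0 < fundamentalForm F x y u u := by
  have h := (hF.posDef x hx y hy).dotProduct_mulVec_pos (x := u.ofLp) (by simpa using hu)
  have e : fundamentalForm F x y u u =
      star u.ofLp ⬝ᵥ (Matrix.mulVec (fundamentalTensor F x y) u.ofLp) := by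
    simp only [fundamentalForm, dotProduct, Matrix.mulVec, Finset.mul_sum]
    exact Finset.sum_congr rfl fun i _ => Finset.sum_congr rfl fun j _ => by
      simp only [Pi.star_apply, star_trivial]
      ring
  rwa [e]

variable (hU : IsOpen U)
include hU

theorem fundamentalForm_comm (u v : Space n) :
    fundamentalForm F x y u v = fundamentalForm F x y v u := by
  simp only [fundamentalForm]
  rw [Finset.sum_comm]
  exact Finset.sum_congr rfl fun i _ => Finset.sum_congr rfl fun j _ => by
    rw [hF.fundamentalTensor_symm hU hx hy]
    ring

theorem fundamentalForm_apply_pole (w : Space n) :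
    fundamentalForm F x y y w = F x y * ∑ k, partialY k F x y * w k := by
  rw [fundamentalForm, Finset.sum_comm, Finset.mul_sum]
  refine Finset.sum_congr rfl fun j _ => ?_
  have := hF.sum_mul_fundamentalTensor hU hx hy j
  rw [hF.partialY_lagrangian hU hx hy] at this
  calc _ = (∑ i, y i * fundamentalTensor F x y i j) * w j := by
        rw [Finset.sum_mul]
        exact Finset.sum_congr rfl fun i _ => by ring
    _ = _ := by rw [this]; ring

theorem fundamentalForm_pole_pole : fundamentalForm F x y y y = F x y ^ 2 := by
  have h := hF.sum_sum_mul_fundamentalTensor hU hx hy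
  rw [lagrangian] at h
  rw [← h, fundamentalForm]
  exact Finset.sum_congr rfl fun i _ => Finset.sum_congr rfl fun j _ => by ring

/-- Cauchy–Schwarz for the inner product `g_y`. With `a = g_y (w, w)` and `b = g_y (w, y)`, the form
at the nonzero vector `a y - b w` equals `a` times the quantity in question. -/
theorem fundamentalForm_cauchySchwarz {w : Space n} (hw : LinearIndependent ℝ ![y, w]) :
    0 < F x y ^ 2 * fundamentalForm F x y w w - fundamentalForm F x y w y ^ 2 := by
  rw [← hF.fundamentalForm_pole_pole hx hy hU]
  have hw0 : w ≠ 0 := hw.ne_zero 1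
  have hww := hF.fundamentalForm_self_pos hx hy hw0
  set a := fundamentalForm F x y w w
  set b := fundamentalForm F x y w y with hb
  have hne : a • y + (-b) • w ≠ 0 := fun h0 => by
    have := (LinearIndependent.pair_iff.1 hw a (-b) h0).1
    exact hww.ne' this
  have hpos := hF.fundamentalForm_self_pos hx hy hne
  rw [fundamentalForm_add_left, fundamentalForm_smul_left, fundamentalForm_smul_left,
    hF.fundamentalForm_comm hx hy hU y, hF.fundamentalForm_comm hx hy hU w,
    fundamentalForm_add_left, fundamentalForm_smul_left, fundamentalForm_smul_left,
    fundamentalForm_add_left, fundamentalForm_smul_left, fundamentalForm_smul_left,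
    hF.fundamentalForm_comm hx hy hU y w] at hpos
  have : 0 < a * (fundamentalForm F x y y y * a - b ^ 2) := by
    refine lt_of_lt_of_eq hpos ?_
    simp only [a, b]
    ring
  exact pos_of_mul_pos_right this hww.le

omit hU in
/-- In dimension at least two every flagpole has a transverse edge orthogonal to it. -/
theorem exists_orthogonal (hn : 2 ≤ n) :
    ∃ w : Space n, LinearIndependent ℝ ![y, w] ∧ fundamentalForm F x y w y = 0 := by
  obtain ⟨v, hv⟩ : ∃ v : Space n, v ∉ Submodule.span ℝ {y} := by
    by_contra! h
    have h1 : (Submodule.span ℝ {y} : Submodule ℝ (Space n)) = ⊤ :=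
      Submodule.eq_top_iff'.2 h
    have h2 := finrank_span_singleton (K := ℝ) hy
    rw [h1, finrank_top, finrank_euclideanSpace_fin] at h2
    omega
  have hyy := hF.fundamentalForm_self_pos hx hy hy
  refine ⟨v + (-(fundamentalForm F x y v y / fundamentalForm F x y y y)) • y, ?_, ?_⟩
  · rw [LinearIndependent.pair_iff' hy]
    intro a ha
    refine hv (Submodule.mem_span_singleton.2
      ⟨a + fundamentalForm F x y v y / fundamentalForm F x y y y, ?_⟩)
    rw [add_smul, ha]
    module
  · rw [fundamentalForm_add_left, fundamentalForm_smul_left]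
    field_simp
    ring

omit hx hy

/-- Constant flag curvature `-1`, for a spray of the form `G^k = P y^k`. -/
theorem sq_sub_sum_partialX_of_flagCurvature (hn : 2 ≤ n) (hP : IsSmoothOffZero U P)
    (hP1 : IsHomogeneousOfDegree U 1 P)
    (hG : ∀ x ∈ U, ∀ y, y ≠ 0 → ∀ k, sprayCoeff F k x y = P x y * y k)
    (hK : HasConstantFlagCurvature U F (-1)) (hx : x ∈ U) (hy : y ≠ 0) :
    P x y ^ 2 - ∑ j, y j * partialX j P x y = -F x y ^ 2 := by
  -- An edge orthogonal to the flagpole makes the unknown term in `τ` vanish; one such flag is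
  -- enough.
  obtain ⟨w, hw, hwy⟩ := hF.exists_orthogonal hx hy hn
  have h := hK x hx y w hw
  rw [flagCurvature_eq (riemannCurvature_of_sprayCoeff_eq hU hP hP1 hG hx hy),
    hF.fundamentalForm_comm hx hy hU y w, hwy, mul_zero, add_zero,
    zero_pow two_ne_zero, sub_zero] at h
  have hw0 : w ≠ 0 := hw.ne_zero 1
  have hww := hF.fundamentalForm_self_pos hx hy hw0
  have hFp := hF.pos x hx y hy
  rw [div_eq_iff (mul_pos (pow_pos hFp 2) hww).ne'] at h
  refine mul_right_cancel₀ hww.ne' ?_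
  rw [h]
  ring

/-- For an arbitrary flag the `τ` term survives. By `h2` it is `g_y (y, w)`, which turns the
numerator into exactly minus the denominator. -/
theorem hasConstantFlagCurvature_neg_one (hP : IsSmoothOffZero U P)
    (hP1 : IsHomogeneousOfDegree U 1 P)
    (hG : ∀ x ∈ U, ∀ y, y ≠ 0 → ∀ k, sprayCoeff F k x y = P x y * y k)
    (h1 : ∀ x ∈ U, ∀ y, y ≠ 0 → P x y ^ 2 - ∑ j, y j * partialX j P x y = -F x y ^ 2)
    (h2 : ∀ x ∈ U, ∀ y, y ≠ 0 → ∀ k, 2 * partialX k P x y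
      - ∑ j, y j * partialX j (partialY k P) x y - P x y * partialY k P x y =
        F x y * partialY k F x y) :
    HasConstantFlagCurvature U F (-1) := by
  intro x hx y w hw
  have hy : y ≠ 0 := hw.ne_zero 0
  rw [flagCurvature_eq (riemannCurvature_of_sprayCoeff_eq hU hP hP1 hG hx hy), h1 x hx y hy,
    div_eq_iff (hF.fundamentalForm_cauchySchwarz hx hy hU hw).ne']
  have : ∑ k, (2 * partialX k P x y - ∑ j, y j * partialX j (partialY k P) x y
      - P x y * partialY k P x y) * w k = fundamentalForm F x y y w := by
    rw [hF.fundamentalForm_apply_pole hx hy hU, Finset.mul_sum]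
    exact Finset.sum_congr rfl fun k _ => by rw [h2 x hx y hy, mul_assoc]
  rw [this, hF.fundamentalForm_comm hx hy hU w y]
  ring

end IsStronglyConvex

end

section

variable {n : ℕ} {U : Set (Space n)} {F : Space n → Space n → ℝ} {x y : Space n}

/-! ### The Funk metric -/

/-- The Funk metric is the Minkowski gauge of `U` seen from `x`. Membership in `U` and in its
frontier are thereby read off from the values `< 1` and `= 1`. -/
theorem funkMetric_eq_gauge (U : Set (Space n)) (x ξ : Space n) :
    funkMetric U x ξ = gauge ((fun v => x + v) ⁻¹' U) ξ := by
  rw [gauge_def']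
  rfl

theorem funkMetric_smul (U : Set (Space n)) (x ξ : Space n) {c : ℝ} (hc : 0 ≤ c) :
    funkMetric U x (c • ξ) = c * funkMetric U x ξ := by
  rw [funkMetric_eq_gauge, funkMetric_eq_gauge, gauge_smul_of_nonneg hc, smul_eq_mul]

theorem funkMetric_zero (U : Set (Space n)) (x : Space n) : funkMetric U x 0 = 0 := by
  rw [funkMetric_eq_gauge, gauge_zero]

section funk

variable (hU : IsOpen U) (hx : x ∈ U)
include hU hx

theorem translate_mem_nhds : (fun v => x + v) ⁻¹' U ∈ 𝓝 (0 : Space n) :=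
  (hU.preimage (continuous_const_add x)).mem_nhds (by simpa using hx)

variable (hconv : Convex ℝ U)
include hconv

theorem funkMetric_lt_one_iff {v : Space n} : funkMetric U x v < 1 ↔ x + v ∈ U := by
  rw [funkMetric_eq_gauge, gauge_lt_one_iff_mem_interior (hconv.translate_preimage_right x)
    (translate_mem_nhds hU hx), (hU.preimage (continuous_const_add x)).interior_eq]
  rfl

theorem funkMetric_eq_one_iff {v : Space n} : funkMetric U x v = 1 ↔ x + v ∈ frontier U := by
  rw [funkMetric_eq_gauge, gauge_eq_one_iff_mem_frontier (hconv.translate_preimage_right x)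
    (translate_mem_nhds hU hx)]
  exact Set.ext_iff.1 ((Homeomorph.addLeft x).preimage_frontier U).symm v

omit hconv in
theorem funkMetric_pos (hbdd : Bornology.IsBounded U) (hy : y ≠ 0) : 0 < funkMetric U x y := by
  rw [funkMetric_eq_gauge, gauge_pos (absorbent_nhds_zero (translate_mem_nhds hU hx))]
  · exact hy
  · rw [NormedSpace.isVonNBounded_iff, isBounded_iff_forall_norm_le]
    obtain ⟨C, hC⟩ := hbdd.exists_norm_le
    refine ⟨C + ‖x‖, fun v hv => ?_⟩
    calc ‖v‖ = ‖(x + v) - x‖ := by rw [add_sub_cancel_left]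
      _ ≤ ‖x + v‖ + ‖x‖ := norm_sub_le _ _
      _ ≤ C + ‖x‖ := by gcongr; exact hC _ hv

theorem funkMetric_mul_lt_one {t : ℝ} (ht : x + t • y ∈ U) : funkMetric U x y * t < 1 := by
  have h0 : 0 ≤ funkMetric U x y := by
    rw [funkMetric_eq_gauge]
    exact gauge_nonneg _
  rcases le_or_gt 0 t with h | h
  · rwa [← funkMetric_lt_one_iff hU hx hconv, funkMetric_smul U x y h, mul_comm] at ht
  · nlinarith

theorem add_smul_mem_of_lt {t : ℝ} (ht0 : 0 ≤ t) (ht : funkMetric U x y * t < 1) :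
    x + t • y ∈ U := by
  rwa [← funkMetric_lt_one_iff hU hx hconv, funkMetric_smul U x y ht0, mul_comm]

/-- The Funk metric along a line. -/
theorem funkMetric_line (hbdd : Bornology.IsBounded U) (hy : y ≠ 0) {t : ℝ}
    (ht : x + t • y ∈ U) :
    funkMetric U (x + t • y) y = funkMetric U x y / (1 - funkMetric U x y * t) := by
  have hα := funkMetric_pos hU hx hbdd hy
  have h1 := funkMetric_mul_lt_one hU hx hconv ht
  set α := funkMetric U x y with hα'
  -- The exit point of the ray is the same for every base point on the line; seen from `x + t y` it
  -- lies at `(α⁻¹ - t) y`.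
  have h2 : x + α⁻¹ • y ∈ frontier U := by
    rw [← funkMetric_eq_one_iff hU hx hconv, funkMetric_smul _ _ _ (inv_nonneg.2 hα.le), ← hα',
      inv_mul_cancel₀ hα.ne']
  have h3 : funkMetric U (x + t • y) ((α⁻¹ - t) • y) = 1 := by
    rw [funkMetric_eq_one_iff hU ht hconv]
    convert h2 using 1
    module
  have h4 : 0 ≤ α⁻¹ - t := by
    rw [sub_nonneg, ← one_div, le_div_iff₀ hα]
    linarith
  rw [funkMetric_smul _ _ _ h4] at h3
  rw [eq_div_iff (by linarith)]
  calc _ = α * ((α⁻¹ - t) * funkMetric U (x + t • y) y) := by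
        field_simp
    _ = _ := by rw [h3, mul_one]

/-- The partial differential equation of the Funk metric. -/
theorem partialX_funkMetric (hbdd : Bornology.IsBounded U)
    (hs : IsSmoothOffZero U (funkMetric U)) (hy : y ≠ 0) (k : Fin n) :
    partialX k (funkMetric U) x y = funkMetric U x y * partialY k (funkMetric U) x y := by
  have hα := funkMetric_pos hU hx hbdd hy
  have hh : IsHomogeneousOfDegree U 1 (funkMetric U) := fun x _ y _ c hc => by
    rw [funkMetric_smul U x y hc.le, pow_one]
  set α := funkMetric U x y with hα'
  have hz : α⁻¹ • y ≠ 0 := smul_ne_zero (inv_ne_zero hα.ne') hy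
  have h2 : x + α⁻¹ • y ∈ frontier U := by
    rw [← funkMetric_eq_one_iff hU hx hconv, funkMetric_smul _ _ _ (inv_nonneg.2 hα.le), ← hα',
      inv_mul_cancel₀ hα.ne']
  -- The base point moves by `t e_k` and the vector by `-t e_k`, so the tip stays on the frontier
  -- and the Funk metric stays `1`. The derivative at `0` gives equal partials at `(x, α⁻¹ y)`;
  -- homogeneity of degrees one and zero supplies the factor `α`.
  have hβ : HasDerivAt (fun t : ℝ => x + t • (basisVec k : Space n)) (basisVec k) 0 := by
    simpa using ((hasDerivAt_id (0 : ℝ)).smul_const (basisVec k : Space n)).const_add x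
  have hγ : HasDerivAt (fun t : ℝ => α⁻¹ • y - t • (basisVec k : Space n)) (-basisVec k) 0 := by
    simpa using ((hasDerivAt_id (0 : ℝ)).smul_const (basisVec k : Space n)).const_sub (α⁻¹ • y)
  have h3 := hs.hasDerivAt_comp hU hβ hγ (by simpa using hx) (by simpa using hz)
  have h4 : (fun t : ℝ => funkMetric U (x + t • (basisVec k : Space n))
      (α⁻¹ • y - t • (basisVec k : Space n))) =ᶠ[𝓝 0] fun _ => 1 := by
    have : ∀ᶠ t : ℝ in 𝓝 0, x + t • (basisVec k : Space n) ∈ U :=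
      hβ.continuousAt.eventually_mem (hU.mem_nhds (by simpa using hx))
    filter_upwards [this] with t ht
    rw [funkMetric_eq_one_iff hU ht hconv]
    convert h2 using 1
    module
  have h5 := h3.unique ((hasDerivAt_const (0 : ℝ) (1 : ℝ)).congr_of_eventuallyEq h4)
  simp only [zero_smul, add_zero, sub_zero, PiLp.neg_apply, neg_mul, Finset.sum_neg_distrib] at h5
  have h6 : ∀ g : Fin n → ℝ, ∑ i, (basisVec k : Space n) i * g i = g k := by
    intro g
    simp [basisVec]
  rw [h6, h6, hh.partialX hs hU k x hx y hy _ (inv_pos.2 hα),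
    (IsHomogeneousOfDegree.partialY (k := 0) hh hs hU k) x hx y hy _ (inv_pos.2 hα)] at h5
  field_simp at h5
  linarith

end funk

end

section

variable {n : ℕ} {U : Set (Space n)} {F A : Space n → Space n → ℝ} {x y : Space n}

/-! ### Spray and curvature of a smooth Hilbert metric -/

section transport

variable (hU : IsOpen U) (hA : IsSmoothOffZero U A) (hA1 : IsHomogeneousOfDegree U 1 A) {σ : ℝ}
  (h : ∀ x ∈ U, ∀ y, y ≠ 0 → ∀ k, partialX k A x y = σ * (A x y * partialY k A x y))
  (hx : x ∈ U) (hy : y ≠ 0)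
include hU hA hA1 h hx hy

/-- The transport equation is differentiated in `y^m` and contracted with `y`; the second
derivatives drop out because `A_{y^m}` has degree zero. It serves for the Funk metric with `σ = 1`
and its reverse with `σ = -1`. -/
theorem sum_mul_partialX_partialY_of_transport (m : Fin n) :
    ∑ j, y j * partialX j (partialY m A) x y = σ * (A x y * partialY m A x y) := by
  have e := hA1.euler hA hU hx hy
  have e0 := (hA1.partialY (k := 0) hA hU m).euler (hA.partialY hU m) hU hx hy
  simp only [Nat.cast_one, one_mul, Nat.cast_zero, zero_mul] at e e0
  have h1 : ∀ j, partialX j (partialY m A) x y =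
      σ * (A x y * partialY j (partialY m A) x y + partialY m A x y * partialY j A x y) := by
    intro j
    rw [partialX_partialY_comm hU hx hy hA, partialY_congr hx hy fun x hx y hy => h x hx y hy j,
      partialY_const_mul hU hx hy (hA.mul (hA.partialY hU j)),
      partialY_mul hU hx hy hA (hA.partialY hU j), partialY_partialY_comm hU hx hy hA m j]
  calc _ = σ * (A x y * ∑ j, y j * partialY j (partialY m A) x y +
        partialY m A x y * ∑ j, y j * partialY j A x y) := by
        simp only [h1, Finset.mul_sum, ← Finset.sum_add_distrib]
        exact Finset.sum_congr rfl fun j _ => by ring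
    _ = _ := by rw [e, e0]; ring

end transport

theorem partialX_comp_neg (f : Space n → Space n → ℝ) (k : Fin n) (x y : Space n) :
    partialX k (fun x y => f x (-y)) x y = partialX k f x (-y) := rfl

theorem partialY_comp_neg (f : Space n → Space n → ℝ) (k : Fin n) (x y : Space n) :
    partialY k (fun x y => f x (-y)) x y = -partialY k f x (-y) := by
  simp only [partialY]
  have := (ContinuousLinearEquiv.neg ℝ (M := Space n)).comp_right_fderiv
    (f := fun v => f x v) (x := y)
  have h2 : (fun v => f x (-v)) = (fun v => f x v) ∘ (ContinuousLinearEquiv.neg ℝ) := rfl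
  rw [h2, this]
  simp

/-- Half the difference of the forward and the backward Funk metric: the projective factor of the
Hilbert metric. -/
noncomputable def hilbertFactor (U : Set (Space n)) (x y : Space n) : ℝ :=
  1 / 2 * (funkMetric U x y - funkMetric U x (-y))

namespace IsStronglyConvex

variable (hF : IsStronglyConvex U F) (hU : IsOpen U) (hconv : Convex ℝ U)
  (hbdd : Bornology.IsBounded U)
  (hH : ∀ x ∈ U, ∀ ξ : Space n, F x ξ = hilbertMetric U x ξ)
include hF hU hconv hbdd hH

/-- Computed from the explicit values of the two Funk metrics on a line, hence without presupposing
that they are smooth. -/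
theorem sum_mul_partialX_of_hilbert (hx : x ∈ U) (hy : y ≠ 0) :
    ∑ j, y j * partialX j F x y = F x y * (funkMetric U x y - funkMetric U x (-y)) := by
  have h1 := hF.isSmoothOffZero.hasDerivAt_line hU (t := 0) (v := y) (x := x)
    (by simpa using hx) hy
  simp only [zero_smul, add_zero] at h1
  set α := funkMetric U x y with hα
  set β := funkMetric U x (-y) with hβ
  have h2 : HasDerivAt (fun t : ℝ => 1 / 2 * (α / (1 - α * t) + β / (1 + β * t)))
      (1 / 2 * (α ^ 2 - β ^ 2)) 0 := by
    have e1 : HasDerivAt (fun t : ℝ => 1 - α * t) (-α) 0 := by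
      simpa using ((hasDerivAt_id (0 : ℝ)).const_mul α).const_sub 1
    have e2 : HasDerivAt (fun t : ℝ => 1 + β * t) β 0 := by
      simpa using ((hasDerivAt_id (0 : ℝ)).const_mul β).const_add 1
    refine ((((hasDerivAt_const (0 : ℝ) α).fun_div e1 (by simp)).fun_add
      ((hasDerivAt_const (0 : ℝ) β).fun_div e2 (by simp))).const_mul (1 / 2 : ℝ)).congr_deriv ?_
    simp
    ring
  have h3 : (fun t : ℝ => F (x + t • y) y) =ᶠ[𝓝 0]
      fun t : ℝ => 1 / 2 * (α / (1 - α * t) + β / (1 + β * t)) := by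
    have hc : Continuous fun t : ℝ => x + t • y := by fun_prop
    have : ∀ᶠ t : ℝ in 𝓝 0, x + t • y ∈ U :=
      hc.continuousAt.eventually_mem (hU.mem_nhds (by simpa using hx))
    filter_upwards [this] with t ht
    have ht' : x + (-t) • (-y) ∈ U := by simpa using ht
    rw [hH _ ht, hilbertMetric, funkMetric_line hU hx hconv hbdd hy ht]
    have := funkMetric_line hU hx hconv hbdd (neg_ne_zero.2 hy) ht'
    rw [neg_smul_neg] at this
    rw [this]
    simp only [mul_neg, sub_neg_eq_add, hα, hβ]
  rw [h1.unique (h2.congr_of_eventuallyEq h3), hH x hx, hilbertMetric]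
  ring

/-- The sum and the difference of the forward and backward Funk metrics are `2 F` and `y^j F_{x^j} /
F`, so the Funk metric is `F + y^j F_{x^j} / (2 F)`. -/
theorem isSmoothOffZero_funkMetric : IsSmoothOffZero U (funkMetric U) := by
  have hs := hF.isSmoothOffZero
  refine (hs.add ((IsSmoothOffZero.sum (s := Finset.univ) fun j _ =>
    (IsSmoothOffZero.coord U j).mul (hs.partialX hU j)).div (hs.const_mul 2) ?_)).congr ?_
  · exact fun x hx y hy => (mul_pos two_pos (hF.pos x hx y hy)).ne'
  · intro x hx y hy
    have hp := hF.pos x hx y hy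
    rw [hF.sum_mul_partialX_of_hilbert hU hconv hbdd hH hx hy]
    have := hH x hx y
    rw [hilbertMetric] at this
    field_simp
    linarith

theorem isSmoothOffZero_funkMetric_neg :
    IsSmoothOffZero U (fun x y => funkMetric U x (-y)) :=
  ((hF.isSmoothOffZero.const_mul 2).sub
    (hF.isSmoothOffZero_funkMetric hU hconv hbdd hH)).congr fun x hx y _ => by
      have := hH x hx y
      rw [hilbertMetric] at this
      linarith

omit hF hU hconv hbdd hH in
theorem isHomogeneous_funkMetric (U : Set (Space n)) :
    IsHomogeneousOfDegree U 1 (funkMetric U) := fun x _ y _ c hc => by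
  rw [funkMetric_smul U x y hc.le, pow_one]

omit hF hU hconv hbdd hH in
theorem isHomogeneous_funkMetric_neg (U : Set (Space n)) :
    IsHomogeneousOfDegree U 1 (fun x y => funkMetric U x (-y)) := fun x _ y _ c hc => by
  beta_reduce
  rw [← smul_neg, funkMetric_smul U x (-y) hc.le, pow_one]

theorem partialX_funkMetric_of_hilbert (hx : x ∈ U) (hy : y ≠ 0) (k : Fin n) :
    partialX k (funkMetric U) x y =
      1 * (funkMetric U x y * partialY k (funkMetric U) x y) := by
  rw [one_mul, partialX_funkMetric hU hx hconv hbdd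
    (hF.isSmoothOffZero_funkMetric hU hconv hbdd hH) hy]

theorem partialX_funkMetric_neg_of_hilbert (hx : x ∈ U) (hy : y ≠ 0) (k : Fin n) :
    partialX k (fun x y => funkMetric U x (-y)) x y =
      -1 * (funkMetric U x (-y) * partialY k (fun x y => funkMetric U x (-y)) x y) := by
  rw [partialX_comp_neg, partialY_comp_neg, partialX_funkMetric hU hx hconv hbdd
    (hF.isSmoothOffZero_funkMetric hU hconv hbdd hH) (neg_ne_zero.2 hy)]
  ring

theorem isSmoothOffZero_hilbertFactor : IsSmoothOffZero U (hilbertFactor U) :=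
  ((hF.isSmoothOffZero_funkMetric hU hconv hbdd hH).sub
    (hF.isSmoothOffZero_funkMetric_neg hU hconv hbdd hH)).const_mul _

omit hF hU hconv hbdd hH in
theorem isHomogeneous_hilbertFactor (U : Set (Space n)) :
    IsHomogeneousOfDegree U 1 (hilbertFactor U) := fun x hx y hy c hc => by
  have h1 := isHomogeneous_funkMetric U x hx y hy c hc
  have h2 := isHomogeneous_funkMetric_neg U x hx y hy c hc
  simp only at h2
  rw [hilbertFactor, h1, h2, hilbertFactor]
  ring

theorem partialY_of_hilbert (hx : x ∈ U) (hy : y ≠ 0) (m : Fin n) :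
    partialY m F x y = 1 / 2 * (partialY m (funkMetric U) x y +
      partialY m (fun x y => funkMetric U x (-y)) x y) := by
  have hA := hF.isSmoothOffZero_funkMetric hU hconv hbdd hH
  have hB := hF.isSmoothOffZero_funkMetric_neg hU hconv hbdd hH
  rw [partialY_congr hx hy (g := fun x y => 1 / 2 * (funkMetric U x y + funkMetric U x (-y)))
    (fun x hx y _ => hH x hx y), partialY_const_mul hU hx hy (hA.add hB),
    partialY_add hU hx hy hA hB]

theorem partialX_of_hilbert (hx : x ∈ U) (hy : y ≠ 0) (m : Fin n) :
    partialX m F x y = 1 / 2 * (funkMetric U x y * partialY m (funkMetric U) x y -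
      funkMetric U x (-y) * partialY m (fun x y => funkMetric U x (-y)) x y) := by
  have hA := hF.isSmoothOffZero_funkMetric hU hconv hbdd hH
  have hB := hF.isSmoothOffZero_funkMetric_neg hU hconv hbdd hH
  rw [partialX_congr hU hx hy (g := fun x y => 1 / 2 * (funkMetric U x y + funkMetric U x (-y)))
    (fun x hx y _ => hH x hx y), partialX_const_mul hU hx hy (hA.add hB),
    partialX_add hU hx hy hA hB, hF.partialX_funkMetric_of_hilbert hU hconv hbdd hH hx hy,
    hF.partialX_funkMetric_neg_of_hilbert hU hconv hbdd hH hx hy]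
  ring

theorem partialX_hilbertFactor (hx : x ∈ U) (hy : y ≠ 0) (m : Fin n) :
    partialX m (hilbertFactor U) x y =
      1 / 2 * (funkMetric U x y * partialY m (funkMetric U) x y +
      funkMetric U x (-y) * partialY m (fun x y => funkMetric U x (-y)) x y) := by
  have hA := hF.isSmoothOffZero_funkMetric hU hconv hbdd hH
  have hB := hF.isSmoothOffZero_funkMetric_neg hU hconv hbdd hH
  have : partialX m (hilbertFactor U) x y = partialX m
    (fun x y => 1 / 2 * (funkMetric U x y - funkMetric U x (-y))) x y := rfl
  rw [this, partialX_const_mul hU hx hy (hA.sub hB),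
    partialX_sub hU hx hy hA hB, hF.partialX_funkMetric_of_hilbert hU hconv hbdd hH hx hy,
    hF.partialX_funkMetric_neg_of_hilbert hU hconv hbdd hH hx hy]
  ring

theorem partialY_hilbertFactor (hx : x ∈ U) (hy : y ≠ 0) (m : Fin n) :
    partialY m (hilbertFactor U) x y = 1 / 2 * (partialY m (funkMetric U) x y -
      partialY m (fun x y => funkMetric U x (-y)) x y) := by
  have hA := hF.isSmoothOffZero_funkMetric hU hconv hbdd hH
  have hB := hF.isSmoothOffZero_funkMetric_neg hU hconv hbdd hH
  have : partialY m (hilbertFactor U) x y = partialY m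
    (fun x y => 1 / 2 * (funkMetric U x y - funkMetric U x (-y))) x y := rfl
  rw [this, partialY_const_mul hU hx hy (hA.sub hB), partialY_sub hU hx hy hA hB]

/-- By the transport equations `y^j F_{x^j y^m} = F_{x^m}`, so the part `2 F F_{x^j y^m}` of `L_{x^j
y^m}` cancels against `L_{x^m}`. What remains is `2 F_{y^m} y^j F_{x^j}`. -/
theorem sprayDefect_of_hilbert (hx : x ∈ U) (hy : y ≠ 0) (m : Fin n) :
    sprayDefect F m x y = 2 * hilbertFactor U x y * partialY m (lagrangian F) x y := by
  have hs := hF.isSmoothOffZero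
  have hA := hF.isSmoothOffZero_funkMetric hU hconv hbdd hH
  have hB := hF.isSmoothOffZero_funkMetric_neg hU hconv hbdd hH
  have eA := sum_mul_partialX_partialY_of_transport hU hA (isHomogeneous_funkMetric U)
    (fun x hx y hy => hF.partialX_funkMetric_of_hilbert hU hconv hbdd hH hx hy) hx hy m
  have eB := sum_mul_partialX_partialY_of_transport hU hB (isHomogeneous_funkMetric_neg U)
    (fun x hx y hy => hF.partialX_funkMetric_neg_of_hilbert hU hconv hbdd hH hx hy) hx hy m
  have e2 : ∀ j, partialX j (partialY m F) x y = 1 / 2 * (partialX j (partialY m (funkMetric U)) x y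
      + partialX j (partialY m (fun x y => funkMetric U x (-y))) x y) := by
    intro j
    rw [partialX_congr hU hx hy fun x hx y hy => hF.partialY_of_hilbert hU hconv hbdd hH hx hy m,
      partialX_const_mul hU hx hy ((hA.partialY hU m).add (hB.partialY hU m)),
      partialX_add hU hx hy (hA.partialY hU m) (hB.partialY hU m)]
  have e1 : ∀ j, partialX j (partialY m (lagrangian F)) x y =
      2 * F x y * partialX j (partialY m F) x y + 2 * partialX j F x y * partialY m F x y := by
    intro j
    rw [partialX_congr hU hx hy fun x hx y hy => hF.partialY_lagrangian hU hx hy m,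
      partialX_mul hU hx hy (hs.const_mul 2) (hs.partialY hU m), partialX_const_mul hU hx hy hs]
  have e3 : ∑ j, y j * partialX j (partialY m (lagrangian F)) x y =
      F x y * (∑ j, y j * partialX j (partialY m (funkMetric U)) x y +
        ∑ j, y j * partialX j (partialY m (fun x y => funkMetric U x (-y))) x y) +
      2 * partialY m F x y * ∑ j, y j * partialX j F x y := by
    simp only [e1, e2, Finset.mul_sum, ← Finset.sum_add_distrib]
    exact Finset.sum_congr rfl fun j _ => by ring
  rw [sprayDefect, e3, eA, eB, hF.sum_mul_partialX_of_hilbert hU hconv hbdd hH hx hy,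
    hF.partialX_lagrangian hU hx hy, hF.partialY_lagrangian hU hx hy,
    hF.partialX_of_hilbert hU hconv hbdd hH hx hy, hilbertFactor]
  ring

/-- A smooth Hilbert metric has constant flag curvature `-1`. -/
theorem hasConstantFlagCurvature_of_hilbert : HasConstantFlagCurvature U F (-1) := by
  have hA := hF.isSmoothOffZero_funkMetric hU hconv hbdd hH
  have hB := hF.isSmoothOffZero_funkMetric_neg hU hconv hbdd hH
  have tA := fun x (hx : x ∈ U) y (hy : y ≠ 0) =>
    hF.partialX_funkMetric_of_hilbert hU hconv hbdd hH hx hy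
  have tB := fun x (hx : x ∈ U) y (hy : y ≠ 0) =>
    hF.partialX_funkMetric_neg_of_hilbert hU hconv hbdd hH hx hy
  refine hF.hasConstantFlagCurvature_neg_one hU
    (hF.isSmoothOffZero_hilbertFactor hU hconv hbdd hH) (isHomogeneous_hilbertFactor U)
    (fun x hx y hy k => hF.sprayCoeff_eq_mul hU hx hy
      (hF.sprayDefect_of_hilbert hU hconv hbdd hH hx hy) k) ?_ ?_
  -- With `A`, `B` the two Funk metrics this is `(A - B)² / 4 - (A² + B²) / 2 = -(A + B)² / 4`.
  · intro x hx y hy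
    have eA := (isHomogeneous_funkMetric U).euler hA hU hx hy
    have eB := (isHomogeneous_funkMetric_neg U).euler hB hU hx hy
    simp only [Nat.cast_one, one_mul] at eA eB
    have : ∑ j, y j * partialX j (hilbertFactor U) x y = 1 / 2 * (funkMetric U x y *
        ∑ j, y j * partialY j (funkMetric U) x y + funkMetric U x (-y) *
        ∑ j, y j * partialY j (fun x y => funkMetric U x (-y)) x y) := by
      simp only [hF.partialX_hilbertFactor hU hconv hbdd hH hx hy, Finset.mul_sum,
        ← Finset.sum_add_distrib]
      exact Finset.sum_congr rfl fun j _ => by ring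
    rw [this, eA, eB, hH x hx, hilbertMetric, hilbertFactor]
    ring
  · intro x hx y hy k
    have e2 : ∀ j, partialX j (partialY k (hilbertFactor U)) x y =
        1 / 2 * (partialX j (partialY k (funkMetric U)) x y
        - partialX j (partialY k (fun x y => funkMetric U x (-y))) x y) := by
      intro j
      rw [partialX_congr hU hx hy fun x hx y hy =>
          hF.partialY_hilbertFactor hU hconv hbdd hH hx hy k,
        partialX_const_mul hU hx hy ((hA.partialY hU k).sub (hB.partialY hU k)),
        partialX_sub hU hx hy (hA.partialY hU k) (hB.partialY hU k)]
    have e3 : ∑ j, y j * partialX j (partialY k (hilbertFactor U)) x y =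
        1 / 2 * (∑ j, y j * partialX j (partialY k (funkMetric U)) x y -
        ∑ j, y j * partialX j (partialY k (fun x y => funkMetric U x (-y))) x y) := by
      simp only [e2, Finset.mul_sum, ← Finset.sum_sub_distrib]
      exact Finset.sum_congr rfl fun j _ => by ring
    rw [e3, sum_mul_partialX_partialY_of_transport hU hA (isHomogeneous_funkMetric U) tA hx hy k,
      sum_mul_partialX_partialY_of_transport hU hB (isHomogeneous_funkMetric_neg U) tB hx hy k,
      hF.partialX_hilbertFactor hU hconv hbdd hH hx hy,
      hF.partialY_hilbertFactor hU hconv hbdd hH hx hy,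
      hF.partialY_of_hilbert hU hconv hbdd hH hx hy, hH x hx, hilbertMetric, hilbertFactor]
    ring

end IsStronglyConvex

end

section

/-! ### First variation -/

section variation

variable {E : Type*} [NormedAddCommGroup E] [NormedSpace ℝ E] {O : Set E} {γ δ : ℝ → E} {a b : ℝ}

theorem exists_cthickening_curve_subset (hO : IsOpen O) (hγ : ContinuousOn γ (Icc a b))
    (hδ : ContinuousOn δ (Icc a b)) (hmem : ∀ s ∈ Icc a b, γ s ∈ O) :
    ∃ ρ > 0, Metric.cthickening ρ (γ '' Icc a b) ⊆ O ∧
      ∃ r > 0, ∀ ε ∈ Metric.ball (0 : ℝ) r, ∀ s ∈ Icc a b,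
        γ s + ε • δ s ∈ Metric.cthickening ρ (γ '' Icc a b) := by
  obtain ⟨ρ, hρ, hsub⟩ := (isCompact_Icc.image_of_continuousOn hγ).exists_cthickening_subset_open
    hO (image_subset_iff.2 hmem)
  obtain ⟨M, hM⟩ := isCompact_Icc.exists_bound_of_continuousOn hδ
  refine ⟨ρ, hρ, hsub, ρ / (|M| + 1), by positivity, fun ε hε s hs => ?_⟩
  refine Metric.mem_cthickening_of_dist_le _ (γ s) _ _ (mem_image_of_mem _ hs) ?_
  rw [dist_eq_norm, add_sub_cancel_left, norm_smul]
  rw [mem_ball_zero_iff, lt_div_iff₀ (by positivity)] at hε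
  refine le_trans ?_ hε.le
  gcongr
  exact ((hM s hs).trans (le_abs_self M)).trans (by linarith)

theorem eventually_forall_add_smul_mem (hO : IsOpen O) (hγ : ContinuousOn γ (Icc a b))
    (hδ : ContinuousOn δ (Icc a b)) (hmem : ∀ s ∈ Icc a b, γ s ∈ O) :
    ∀ᶠ ε : ℝ in 𝓝 0, ∀ s ∈ Icc a b, γ s + ε • δ s ∈ O := by
  obtain ⟨ρ, -, hsub, r, hr, h⟩ := exists_cthickening_curve_subset hO hγ hδ hmem
  filter_upwards [Metric.ball_mem_nhds (0 : ℝ) hr] with ε hε s hs using hsub (h ε hε s hs)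

/-- Differentiation under the integral. For small `ε` the varied curves stay in a compact thickening
of the image of `γ` inside `O`; there the derivative of `Φ` is bounded, which provides the
dominating constant. -/
theorem hasDerivAt_integral_variation [ProperSpace E] {Φ : E → ℝ} (hO : IsOpen O)
    (hΦ : ContDiffOn ℝ 1 Φ O) (hab : a ≤ b) (hγ : ContinuousOn γ (Icc a b))
    (hδ : ContinuousOn δ (Icc a b)) (hmem : ∀ s ∈ Icc a b, γ s ∈ O) :
    HasDerivAt (fun ε : ℝ => ∫ s in a..b, Φ (γ s + ε • δ s))
      (∫ s in a..b, fderiv ℝ Φ (γ s) (δ s)) 0 := by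
  obtain ⟨ρ, -, hsub, r, hr, h⟩ := exists_cthickening_curve_subset hO hγ hδ hmem
  have hK : IsCompact (Metric.cthickening ρ (γ '' Icc a b)) :=
    (isCompact_Icc.image_of_continuousOn hγ).cthickening
  have hΦ' : ContinuousOn (fderiv ℝ Φ) O := hΦ.continuousOn_fderiv_of_isOpen hO le_rfl
  obtain ⟨C, hC⟩ := hK.exists_bound_of_continuousOn (hΦ'.mono hsub)
  obtain ⟨M, hM⟩ := isCompact_Icc.exists_bound_of_continuousOn hδ
  have hI : uIoc a b ⊆ Icc a b := by
    rw [uIoc_of_le hab]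
    exact Ioc_subset_Icc_self
  have hcont : ∀ ε ∈ Metric.ball (0 : ℝ) r,
      ContinuousOn (fun s => Φ (γ s + ε • δ s)) (Icc a b) := fun ε hε =>
    hΦ.continuousOn.comp (hγ.add (hδ.const_smul ε)) fun s hs => hsub (h ε hε s hs)
  have h0 : (0 : ℝ) ∈ Metric.ball (0 : ℝ) r := Metric.mem_ball_self hr
  have key := intervalIntegral.hasDerivAt_integral_of_dominated_loc_of_deriv_le
    (μ := MeasureTheory.volume) (a := a) (b := b) (F := fun ε s => Φ (γ s + ε • δ s))
    (F' := fun ε s => fderiv ℝ Φ (γ s + ε • δ s) (δ s)) (x₀ := 0) (bound := fun _ => C * M)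
    (Metric.ball_mem_nhds (0 : ℝ) hr) ?_ ?_ ?_ ?_ ?_ ?_
  · simpa using key.2
  · filter_upwards [Metric.ball_mem_nhds (0 : ℝ) hr] with ε hε
    exact ((hcont ε hε).mono hI).aestronglyMeasurable measurableSet_uIoc
  · exact ((hcont 0 h0).mono (by rw [uIcc_of_le hab])).intervalIntegrable
  · simp only [zero_smul, add_zero]
    exact (((hΦ'.comp hγ hmem).clm_apply hδ).mono hI).aestronglyMeasurable measurableSet_uIoc
  · refine Eventually.of_forall fun s hs ε hε => ?_
    have hs' := hI hs
    refine (ContinuousLinearMap.le_opNorm _ _).trans ?_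
    have h1 := hC _ (h ε hε s hs')
    exact mul_le_mul h1 (hM s hs') (norm_nonneg _) ((norm_nonneg _).trans h1)
  · exact intervalIntegrable_const
  · refine Eventually.of_forall fun s hs ε hε => ?_
    have hs' := hI hs
    have hd : DifferentiableAt ℝ Φ (γ s + ε • δ s) :=
      (hΦ.contDiffAt (hO.mem_nhds (hsub (h ε hε s hs')))).differentiableAt one_ne_zero
    have h1 : HasDerivAt (fun t : ℝ => γ s + t • δ s) (δ s) ε := by
      simpa using ((hasDerivAt_id ε).smul_const (δ s)).const_add (γ s)
    exact hd.hasFDerivAt.comp_hasDerivAt ε h1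

end variation

/-- The lemma of du Bois-Reymond. -/
theorem hasDerivAt_of_integral_variation_eq_zero {c d : ℝ} (hcd : c < d) {u v : ℝ → ℝ}
    (hu : ContinuousOn u (Icc c d)) (hv : ContinuousOn v (Icc c d))
    (h : ∀ φ k : ℝ → ℝ, Continuous k → (∀ s, HasDerivAt φ (k s) s) →
      (∀ s, s ∉ Ioo c d → φ s = 0 ∧ k s = 0) → ∫ s in c..d, (φ s * u s + k s * v s) = 0)
    {s : ℝ} (hs : s ∈ Ioo c d) : HasDerivAt v (u s) s := by
  set u' : ℝ → ℝ := IccExtend hcd.le ((Icc c d).domRestrict u) with hu'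
  set v' : ℝ → ℝ := IccExtend hcd.le ((Icc c d).domRestrict v) with hv'
  have hu'c : Continuous u' := continuous_IccExtend_iff.2 hu.domRestrict
  have hv'c : Continuous v' := continuous_IccExtend_iff.2 hv.domRestrict
  have hu'e : ∀ s ∈ Icc c d, u' s = u s := fun s hs => by
    simp [hu', IccExtend_of_mem hcd.le _ hs]
  have hv'e : ∀ s ∈ Icc c d, v' s = v s := fun s hs => by
    simp [hv', IccExtend_of_mem hcd.le _ hs]
  set V : ℝ → ℝ := fun s => ∫ t in c..s, u' t with hV
  have hVd : ∀ s, HasDerivAt V (u' s) s := fun s => hu'c.integral_hasStrictDerivAt c s |>.hasDerivAt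
  have hVc : Continuous V := continuous_iff_continuousAt.2 fun s => (hVd s).continuousAt
  -- A continuous weight, positive exactly on `(c, d)`, so that the test function and its derivative
  -- vanish outside the interval.
  set w : ℝ → ℝ := fun s => max 0 ((s - c) * (d - s)) with hw
  have hwc : Continuous w := by fun_prop
  have hw0 : ∀ s, s ∉ Ioo c d → w s = 0 := by
    intro s hs
    refine max_eq_left ?_
    rcases le_or_gt s c with h1 | h1
    · exact mul_nonpos_of_nonpos_of_nonneg (by linarith) (by linarith)
    · have : d ≤ s := not_lt.1 fun h2 => hs ⟨h1, h2⟩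
      exact mul_nonpos_of_nonneg_of_nonpos (by linarith) (by linarith)
  have hwp : ∀ s ∈ Ioo c d, 0 < w s := fun s hs =>
    lt_max_of_lt_right (mul_pos (sub_pos.2 hs.1) (sub_pos.2 hs.2))
  have hwn : ∀ s, 0 ≤ w s := fun s => le_max_left _ _
  set m : ℝ := (c + d) / 2
  have hm : m ∈ Ioo c d := ⟨by simp only [m]; linarith, by simp only [m]; linarith⟩
  have hwI : 0 < ∫ s in c..d, w s :=
    intervalIntegral.integral_pos hcd hwc.continuousOn (fun s _ => hwn s)
      ⟨m, Ioo_subset_Icc_self hm, hwp m hm⟩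
  set q : ℝ → ℝ := fun s => v' s - V s with hq
  have hqc : Continuous q := hv'c.sub hVc
  -- The weighted mean of `q`: this choice makes `k` have integral zero, so its primitive `φ`
  -- vanishes beyond `d` as well.
  set C : ℝ := (∫ s in c..d, w s * q s) / ∫ s in c..d, w s with hC
  set k : ℝ → ℝ := fun s => w s * (q s - C) with hk
  have hkc : Continuous k := hwc.mul (hqc.sub continuous_const)
  have hk0 : ∀ s, s ∉ Ioo c d → k s = 0 := fun s hs => by simp [hk, hw0 s hs]
  have hkI : ∫ s in c..d, k s = 0 := by
    have : ∀ s, k s = w s * q s - w s * C := fun s => by simp only [hk]; ring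
    simp only [this]
    rw [intervalIntegral.integral_sub (f := fun s => w s * q s) (g := fun s => w s * C)
      (Continuous.intervalIntegrable (by fun_prop) _ _)
      (Continuous.intervalIntegrable (by fun_prop) _ _), intervalIntegral.integral_mul_const, hC]
    field_simp
    ring
  set φ : ℝ → ℝ := fun s => ∫ t in c..s, k t with hφ
  have hφd : ∀ s, HasDerivAt φ (k s) s := fun s => hkc.integral_hasStrictDerivAt c s |>.hasDerivAt
  have hφc : Continuous φ := continuous_iff_continuousAt.2 fun s => (hφd s).continuousAt
  have hφ0 : ∀ s, s ∉ Ioo c d → φ s = 0 := by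
    intro s hs
    rcases le_or_gt s c with h1 | h1
    · have : ∫ t in c..s, k t = ∫ t in c..s, (0 : ℝ) := by
        refine intervalIntegral.integral_congr fun t ht => hk0 t fun h2 => ?_
        rw [uIcc_of_ge h1] at ht
        exact absurd h2.1 (not_lt.2 ht.2)
      simp only [hφ, this, intervalIntegral.integral_zero]
    · have h2 : d ≤ s := not_lt.1 fun h2 => hs ⟨h1, h2⟩
      have : ∫ t in d..s, k t = ∫ t in d..s, (0 : ℝ) := by
        refine intervalIntegral.integral_congr fun t ht => hk0 t fun h3 => ?_
        rw [uIcc_of_le h2] at ht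
        exact absurd h3.2 (not_lt.2 ht.1)
      simp only [hφ]
      rw [← intervalIntegral.integral_add_adjacent_intervals (hkc.intervalIntegrable c d)
        (hkc.intervalIntegrable d s), hkI, this]
      simp
  have h1 := h φ k hkc hφd fun s hs => ⟨hφ0 s hs, hk0 s hs⟩
  have h2 : ∫ s in c..d, (φ s * u' s + k s * v' s) = 0 := by
    rw [← h1]
    refine intervalIntegral.integral_congr fun t ht => ?_
    rw [uIcc_of_le hcd.le] at ht
    simp only [hu'e t ht, hv'e t ht]
  -- Integration by parts: the integrand is the derivative of `φ V`, which vanishes at both ends.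
  -- Subtracting it from the hypothesis leaves the integral of `w (q - C)²`.
  have h3 : ∫ s in c..d, (k s * V s + φ s * u' s) = 0 := by
    rw [intervalIntegral.integral_eq_sub_of_hasDerivAt (fun s _ => (hφd s).mul (hVd s))
      (((hkc.mul hVc).add (hφc.mul hu'c)).intervalIntegrable _ _), Pi.mul_apply, Pi.mul_apply,
      hφ0 c (by simp), hφ0 d (by simp)]
    ring
  have h4 : ∫ s in c..d, w s * (q s - C) ^ 2 = 0 := by
    have : ∀ s, w s * (q s - C) ^ 2 =
        (φ s * u' s + k s * v' s) - (k s * V s + φ s * u' s) - C * k s := fun s => by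
      simp only [hk, hq]
      ring
    simp only [this]
    rw [intervalIntegral.integral_sub, intervalIntegral.integral_sub, h2, h3,
      intervalIntegral.integral_const_mul, hkI]
    · ring
    all_goals exact Continuous.intervalIntegrable (by fun_prop) _ _
  have h5 : ∀ s ∈ Ioo c d, q s = C := by
    intro s hs
    by_contra hne
    refine h4.not_gt (intervalIntegral.integral_pos hcd (by fun_prop)
      (fun s _ => mul_nonneg (hwn s) (sq_nonneg _)) ⟨s, Ioo_subset_Icc_self hs, ?_⟩)
    have := sub_ne_zero.2 hne
    exact mul_pos (hwp s hs) (by positivity)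
  have h6 : v =ᶠ[𝓝 s] fun s => V s + C := by
    filter_upwards [Ioo_mem_nhds hs.1 hs.2] with t ht
    rw [← hv'e t (Ioo_subset_Icc_self ht), ← h5 t ht]
    simp [hq]
  rw [← hu'e s (Ioo_subset_Icc_self hs)]
  exact ((hVd s).add_const C).congr_of_eventuallyEq h6

variable {n : ℕ} {U : Set (Space n)} {F P : Space n → Space n → ℝ} {a b : ℝ}

/-- A solution of the second order equation `β'' = -2 P β'` of a spray `G^k = P y^k` is
a geodesic. -/
theorem IsStronglyConvex.isGeodesic_of_hasDerivAt (hF : IsStronglyConvex U F) (hU : IsOpen U)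
    (hP : ∀ x ∈ U, ∀ y, y ≠ 0 → ∀ m,
      sprayDefect F m x y = 2 * P x y * partialY m (lagrangian F) x y) (hab : a < b)
    {β γ : ℝ → Space n} (hβ1 : ContDiffOn ℝ 1 β (Icc a b))
    (hβ : ∀ s ∈ Icc a b, HasDerivAt β (γ s) s)
    (hγ : ∀ s ∈ Icc a b, HasDerivAt γ (-(2 * P (β s) (γ s)) • γ s) s)
    (hmem : ∀ s ∈ Icc a b, β s ∈ U) (hne : ∀ s ∈ Icc a b, γ s ≠ 0) :
    IsGeodesic U F a b β := by
  refine ⟨hβ1, hmem, fun η hη ha hb => ?_⟩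
  have hL := hF.isSmoothOffZero_lagrangian
  have hud := uniqueDiffOn_Icc hab
  set η' : ℝ → Space n := derivWithin η (Icc a b) with hη'
  have hηd : ∀ s ∈ Icc a b, HasDerivWithinAt η (η' s) (Icc a b) s := fun s hs =>
    ((hη.differentiableOn one_ne_zero) s hs).hasDerivWithinAt
  have hη'c : ContinuousOn η' (Icc a b) := hη.continuousOn_derivWithin hud le_rfl
  have hβc : ContinuousOn β (Icc a b) := hβ1.continuousOn
  have hγc : ContinuousOn γ (Icc a b) := fun s hs => (hγ s hs).continuousAt.continuousWithinAt
  have hvar := hasDerivAt_integral_variation (isOpen_slit hU)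
    (ContDiffOn.of_le hL (by simp) : ContDiffOn ℝ 1 _ _) hab.le
    (hβc.prodMk hγc) (hη.continuousOn.prodMk hη'c) fun s hs => ⟨hmem s hs, hne s hs⟩
  have hE : (fun ε : ℝ => energy F a b fun s => β s + ε • η s) = fun ε : ℝ =>
      ∫ s in a..b, (fun p : Space n × Space n => lagrangian F p.1 p.2)
        ((β s, γ s) + ε • (η s, η' s)) := by
    funext ε
    refine intervalIntegral.integral_congr fun s hs => ?_
    rw [uIcc_of_le hab.le] at hs
    have : derivWithin (fun s => β s + ε • η s) (Icc a b) s = γ s + ε • η' s :=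
      ((hβ s hs).hasDerivWithinAt.add ((hηd s hs).const_smul ε)).derivWithin (hud s hs)
    simp [this, lagrangian]
  rw [hE]
  convert hvar using 1
  -- The first variation integrates the exact derivative of `η^m L_{y^m}`, because `L_{y^m}` has
  -- derivative `L_{x^m}` along the curve; the boundary terms vanish with `η`.
  have hpart := intervalIntegral.integral_eq_sub_of_hasDerivAt_of_le hab.le
    (f := fun s => ∑ m, η s m * partialY m (lagrangian F) (β s) (γ s))
    (f' := fun s => fderiv ℝ (fun p : Space n × Space n => lagrangian F p.1 p.2)
      (β s, γ s) (η s, η' s)) ?_ ?_ ?_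
  · rw [hpart, ha, hb]
    simp
  · refine continuousOn_finsetSum _ fun m _ => ContinuousOn.mul ?_ ?_
    · exact (EuclideanSpace.proj (𝕜 := ℝ) m).continuous.comp_continuousOn hη.continuousOn
    · exact (ContDiffOn.continuousOn (hL.partialY hU m)).comp (hβc.prodMk hγc)
        fun s hs => ⟨hmem s hs, hne s hs⟩
  · intro s hs
    have hs' := Ioo_subset_Icc_self hs
    have hx := hmem s hs'
    have hy := hne s hs'
    have hηs : HasDerivAt η (η' s) s := (hηd s hs').hasDerivAt (Icc_mem_nhds hs.1 hs.2)
    have h1 : ∀ m, HasDerivAt (fun s => partialY m (lagrangian F) (β s) (γ s))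
        (partialX m (lagrangian F) (β s) (γ s)) s := by
      intro m
      refine ((hL.partialY hU m).hasDerivAt_comp hU (hβ s hs') (hγ s hs') hx hy).congr_deriv ?_
      have e1 := (hF.isHomogeneous_partialY_lagrangian hU m).euler (hL.partialY hU m) hU hx hy
      have e2 := hP _ hx _ hy m
      rw [sprayDefect] at e2
      simp only [PiLp.smul_apply, smul_eq_mul, mul_assoc, ← Finset.mul_sum]
      rw [e1]
      push_cast
      linarith
    have h2 : ∀ m, HasDerivAt (fun s => η s m) (η' s m) s := fun m =>
      (EuclideanSpace.proj (𝕜 := ℝ) m).hasFDerivAt.comp_hasDerivAt s hηs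
    refine (HasDerivAt.fun_sum fun m _ => (h2 m).mul (h1 m)).congr_deriv ?_
    rw [hL.fderiv_apply hU hx hy, ← Finset.sum_add_distrib]
    exact Finset.sum_congr rfl fun m _ => by ring
  · refine ContinuousOn.intervalIntegrable ?_
    rw [uIcc_of_le hab.le]
    have hΦ' : ContinuousOn (fderiv ℝ fun p : Space n × Space n => lagrangian F p.1 p.2)
        (U ×ˢ {0}ᶜ) :=
      ContDiffOn.continuousOn_fderiv_of_isOpen hL (isOpen_slit hU) (by simp)
    exact (hΦ'.comp (hβc.prodMk hγc) fun s hs => ⟨hmem s hs, hne s hs⟩).clm_apply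
      (hη.continuousOn.prodMk hη'c)

end

section

variable {n : ℕ} {U : Set (Space n)} {F : Space n → Space n → ℝ} {x y : Space n} {a b : ℝ}

/-! ### Projectively flat metrics -/

namespace IsStronglyConvex

variable (hF : IsStronglyConvex U F) (hU : IsOpen U)
include hF hU

/-- `F²` need not be twice differentiable on the zero section and the velocity may vanish somewhere.
The variation `φ e_m` is therefore supported in a subinterval without zeros of the velocity, and the
energy outside does not change. -/
theorem integral_variation_of_isGeodesic {β : ℝ → Space n} (hab : a < b)
    (hg : IsGeodesic U F a b β) {c d : ℝ} (hcd : c < d) (hsub : Icc c d ⊆ Ioo a b)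
    (hne : ∀ s ∈ Icc c d, derivWithin β (Icc a b) s ≠ 0) {φ k : ℝ → ℝ} (hk : Continuous k)
    (hφ : ∀ s, HasDerivAt φ (k s) s) (h0 : ∀ s, s ∉ Ioo c d → φ s = 0 ∧ k s = 0) (m : Fin n) :
    ∫ s in c..d, (φ s * partialX m (lagrangian F) (β s) (derivWithin β (Icc a b) s) +
      k s * partialY m (lagrangian F) (β s) (derivWithin β (Icc a b) s)) = 0 := by
  have hL := hF.isSmoothOffZero_lagrangian
  have hud := uniqueDiffOn_Icc hab
  have hca : a < c := (hsub ⟨le_rfl, hcd.le⟩).1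
  have hdb : d < b := (hsub ⟨hcd.le, le_rfl⟩).2
  have hsub' : Icc c d ⊆ Icc a b := hsub.trans Ioo_subset_Icc_self
  set γ : ℝ → Space n := derivWithin β (Icc a b) with hγ
  set η : ℝ → Space n := fun s => φ s • basisVec m with hη
  set η' : ℝ → Space n := fun s => k s • basisVec m with hη'
  have hηd : ∀ s, HasDerivAt η (η' s) s := fun s => (hφ s).smul_const _
  have hη'c : Continuous η' := hk.smul continuous_const
  have hηc : Continuous η := continuous_iff_continuousAt.2 fun s => (hηd s).continuousAt
  have hη1 : ContDiff ℝ 1 η := contDiff_one_iff_deriv.2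
    ⟨fun s => (hηd s).differentiableAt, by rwa [funext fun s => (hηd s).deriv]⟩
  have hβc : ContinuousOn β (Icc a b) := hg.contDiffOn.continuousOn
  have hγc : ContinuousOn γ (Icc a b) := hg.contDiffOn.continuousOn_derivWithin hud le_rfl
  have hO : ∀ s ∈ Icc c d, (β s, γ s) ∈ U ×ˢ ({0}ᶜ : Set (Space n)) := fun s hs =>
    ⟨hg.mem s (hsub' hs), hne s hs⟩
  have hβγ : ContinuousOn (fun s => (β s, γ s)) (Icc c d) := (hβc.mono hsub').prodMk (hγc.mono hsub')
  have hηη : ContinuousOn (fun s => (η s, η' s)) (Icc c d) := (hηc.prodMk hη'c).continuousOn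
  have hvar := hasDerivAt_integral_variation (isOpen_slit hU)
    (ContDiffOn.of_le hL (by simp) : ContDiffOn ℝ 1 _ _) hcd.le hβγ hηη hO
  have hder : ∀ ε : ℝ, ∀ s ∈ Icc a b,
      derivWithin (fun s => β s + ε • η s) (Icc a b) s = γ s + ε • η' s := fun ε s hs =>
    ((((hg.contDiffOn.differentiableOn one_ne_zero) s hs).hasDerivWithinAt).add
      ((hηd s).hasDerivWithinAt.const_smul ε)).derivWithin (hud s hs)
  have hz : ∀ s, s ∉ Ioo c d → η s = 0 ∧ η' s = 0 := fun s hs => by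
    simp [hη, hη', h0 s hs]
  have hcrit := hg.critical η hη1.contDiffOn (hz a fun h => h.1.not_gt hca).1
    (hz b fun h => h.2.not_gt hdb).1
  have hev : (fun ε : ℝ => energy F a b fun s => β s + ε • η s) =ᶠ[𝓝 0] fun ε : ℝ =>
      ((∫ s in a..c, lagrangian F (β s) (γ s)) + ∫ s in d..b, lagrangian F (β s) (γ s)) +
      ∫ s in c..d, (fun p : Space n × Space n => lagrangian F p.1 p.2)
        ((β s, γ s) + ε • (η s, η' s)) := by
    filter_upwards [eventually_forall_add_smul_mem (isOpen_slit hU) hβγ hηη hO] with ε hε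
    set g : ℝ → ℝ := fun s => lagrangian F (β s + ε • η s) (γ s + ε • η' s) with hgdef
    have hgc : ContinuousOn g (Icc a b) := by
      refine (hF.continuousOn.comp
        ((hβc.add (hηc.continuousOn.const_smul ε)).prodMk
          (hγc.add (hη'c.continuousOn.const_smul ε))) fun s hs => ⟨?_, mem_univ _⟩).pow 2
      by_cases h : s ∈ Icc c d
      · exact (hε s h).1
      · have := (hz s fun h' => h (Ioo_subset_Icc_self h')).1
        simpa [this] using hg.mem s hs
    have hgi : ∀ u ∈ Icc a b, ∀ v ∈ Icc a b, u ≤ v →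
        IntervalIntegrable g MeasureTheory.volume u v := fun u hu v hv huv =>
      (hgc.mono (by rw [uIcc_of_le huv]; exact Icc_subset_Icc hu.1 hv.2)).intervalIntegrable
    have h1 : (energy F a b fun s => β s + ε • η s) = ∫ s in a..b, g s := by
      refine intervalIntegral.integral_congr fun s hs => ?_
      rw [uIcc_of_le hab.le] at hs
      simp only [hder ε s hs, hgdef, lagrangian]
    have ma : a ∈ Icc a b := ⟨le_rfl, hab.le⟩
    have mc : c ∈ Icc a b := hsub' ⟨le_rfl, hcd.le⟩
    have md : d ∈ Icc a b := hsub' ⟨hcd.le, le_rfl⟩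
    have mb : b ∈ Icc a b := ⟨hab.le, le_rfl⟩
    have h2 : ∫ s in a..c, g s = ∫ s in a..c, lagrangian F (β s) (γ s) := by
      refine intervalIntegral.integral_congr fun s hs => ?_
      rw [uIcc_of_le hca.le] at hs
      have := hz s fun h => h.1.not_ge hs.2
      simp [hgdef, this]
    have h3 : ∫ s in d..b, g s = ∫ s in d..b, lagrangian F (β s) (γ s) := by
      refine intervalIntegral.integral_congr fun s hs => ?_
      rw [uIcc_of_le hdb.le] at hs
      have := hz s fun h => h.2.not_ge hs.1
      simp [hgdef, this]
    rw [h1, ← intervalIntegral.integral_add_adjacent_intervals (hgi a ma d md (hca.trans hcd).le)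
      (hgi d md b mb hdb.le), ← intervalIntegral.integral_add_adjacent_intervals
      (hgi a ma c mc hca.le) (hgi c mc d md hcd.le), h2, h3]
    simp only [hgdef, Prod.mk_add_mk, Prod.smul_mk]
    ring
  have h4 := (hvar.const_add _).unique (hcrit.congr_of_eventuallyEq hev.symm)
  rw [← h4]
  refine intervalIntegral.integral_congr fun s hs => ?_
  rw [uIcc_of_le hcd.le] at hs
  have h6 : ∀ g : Fin n → ℝ, ∀ t : ℝ, ∑ i, (t • (basisVec m : Space n)) i * g i = t * g m := by
    intro g t
    simp [basisVec]
  simp only [hL.fderiv_apply hU (hO s hs).1 (hO s hs).2, hη, hη', h6]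

/-- Euler's equation along a geodesic that runs through a segment. -/
theorem exists_sprayDefect_of_isGeodesic {β : ℝ → Space n} (hab : a < b)
    (hg : IsGeodesic U F a b β) {p e : Space n} (he : e ≠ 0)
    (hseg : ∀ s ∈ Icc a b, β s ∈ segment ℝ p (p + e)) (hβa : β a = p) (hβb : β b = p + e) :
    ∃ z ∈ segment ℝ p (p + e), z ∈ U ∧ ∃ κ : ℝ, 0 < κ ∧ ∃ μ : ℝ, ∀ m,
      sprayDefect F m z (κ • e) = μ * partialY m (lagrangian F) z (κ • e) := by
  have hL := hF.isSmoothOffZero_lagrangian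
  have hud := uniqueDiffOn_Icc hab
  have hee : inner ℝ e e ≠ 0 := inner_self_ne_zero.2 he
  -- The affine coordinate on the segment, recovered from `β` by projection and therefore of class
  -- `C¹`.
  set θ : ℝ → ℝ := fun s => inner ℝ e (β s - p) / inner ℝ e e with hθ
  have hβθ : ∀ s ∈ Icc a b, β s = p + θ s • e := by
    intro s hs
    obtain ⟨t, -, ht⟩ := (segment_eq_image' ℝ p (p + e)) ▸ hseg s hs
    rw [add_sub_cancel_left] at ht
    have : θ s = t := by
      simp only [hθ, ← ht, add_sub_cancel_left, inner_smul_right]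
      field_simp
    rw [this, ← ht]
  have hθ1 : ContDiffOn ℝ 1 θ (Icc a b) :=
    (contDiffOn_const.inner ℝ (hg.contDiffOn.sub contDiffOn_const)).div_const _
  set θ' : ℝ → ℝ := derivWithin θ (Icc a b) with hθ'
  have hθd : ∀ s ∈ Icc a b, HasDerivWithinAt θ (θ' s) (Icc a b) s := fun s hs =>
    ((hθ1.differentiableOn one_ne_zero) s hs).hasDerivWithinAt
  have hθ'c : ContinuousOn θ' (Icc a b) := hθ1.continuousOn_derivWithin hud le_rfl
  have hθdd : ∀ s ∈ Ioo a b, HasDerivAt θ (θ' s) s := fun s hs =>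
    (hθd s (Ioo_subset_Icc_self hs)).hasDerivAt (Icc_mem_nhds hs.1 hs.2)
  -- The parametrization may have stationary points; since `θ` increases from `0` to `1`, the mean
  -- value theorem yields an instant with positive speed.
  obtain ⟨s₀, hs₀, hs₀'⟩ := exists_hasDerivAt_eq_slope θ θ' hab hθ1.continuousOn hθdd
  have hpos : 0 < θ' s₀ := by
    have h1 : θ a = 0 := by simp [hθ, hβa]
    have h2 : θ b = 1 := by
      simp only [hθ, hβb, add_sub_cancel_left]
      exact div_self hee
    rw [hs₀', h1, h2]
    exact div_pos (by norm_num) (sub_pos.2 hab)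
  have hev : ∀ᶠ s in 𝓝 s₀, 0 < θ' s ∧ s ∈ Ioo a b :=
    ((hθ'c.continuousAt (Icc_mem_nhds hs₀.1 hs₀.2)).eventually (lt_mem_nhds hpos)).and
      (Ioo_mem_nhds hs₀.1 hs₀.2)
  obtain ⟨r, hr, hrs⟩ := (nhds_basis_Icc_pos s₀).eventually_iff.1 hev
  have hcd : s₀ - r < s₀ + r := by linarith
  set c := s₀ - r
  set d := s₀ + r
  have hs₀cd : s₀ ∈ Ioo c d := ⟨by simp only [c]; linarith, by simp only [d]; linarith⟩
  have hsub : Icc c d ⊆ Ioo a b := fun s hs => (hrs hs).2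
  have hsub' : Icc c d ⊆ Icc a b := hsub.trans Ioo_subset_Icc_self
  set γ : ℝ → Space n := derivWithin β (Icc a b) with hγdef
  have hγ : ∀ s ∈ Icc a b, γ s = θ' s • e := by
    intro s hs
    have : HasDerivWithinAt β (θ' s • e) (Icc a b) s := by
      refine HasDerivWithinAt.congr (((hθd s hs).smul_const e).const_add p) hβθ (hβθ s hs)
    exact this.derivWithin (hud s hs)
  have hne : ∀ s ∈ Icc c d, γ s ≠ 0 := fun s hs => by
    rw [hγ s (hsub' hs)]
    exact smul_ne_zero (hrs hs).1.ne' he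
  have hβc : ContinuousOn β (Icc c d) := hg.contDiffOn.continuousOn.mono hsub'
  have hγc : ContinuousOn γ (Icc c d) :=
    (hg.contDiffOn.continuousOn_derivWithin hud le_rfl).mono hsub'
  have hmaps : MapsTo (fun s => (β s, γ s)) (Icc c d) (U ×ˢ ({0}ᶜ : Set (Space n))) := fun s hs =>
    ⟨hg.mem s (hsub' hs), hne s hs⟩
  have hv : ∀ m, ∀ s ∈ Ioo c d, HasDerivAt (fun s => partialY m (lagrangian F) (β s) (γ s))
      (partialX m (lagrangian F) (β s) (γ s)) s := fun m s hs =>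
    hasDerivAt_of_integral_variation_eq_zero hcd
      ((ContDiffOn.continuousOn (hL.partialX hU m)).comp (hβc.prodMk hγc) hmaps)
      ((ContDiffOn.continuousOn (hL.partialY hU m)).comp (hβc.prodMk hγc) hmaps)
      (fun φ k hk hφ h0 => hF.integral_variation_of_isGeodesic hU hab hg hcd hsub hne hk hφ h0 m) hs
  have hx := hg.mem s₀ (Ioo_subset_Icc_self hs₀)
  have hs₀c := Ioo_subset_Icc_self hs₀cd
  have hy := hne s₀ hs₀c
  have hβd : HasDerivAt β (γ s₀) s₀ :=
    (((hg.contDiffOn.differentiableOn one_ne_zero) s₀ (hsub' hs₀c)).hasDerivWithinAt).hasDerivAt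
      (Icc_mem_nhds hs₀.1 hs₀.2)
  have hLpos : ∀ s ∈ Icc c d, 0 < lagrangian F (β s) e := fun s hs =>
    pow_pos (hF.pos _ (hg.mem s (hsub' hs)) _ he) 2
  -- Regularity gain: `β` is only `C¹`, but by homogeneity and Euler's relation its speed is a
  -- quotient of differentiable functions, as du Bois-Reymond's lemma makes each `L_{y^m}`
  -- differentiable along the curve.
  have hθeq : θ' =ᶠ[𝓝 s₀] fun s =>
      (∑ m, e m * partialY m (lagrangian F) (β s) (γ s)) / (2 * lagrangian F (β s) e) := by
    filter_upwards [Ioo_mem_nhds hs₀cd.1 hs₀cd.2] with s hs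
    have hs' := Ioo_subset_Icc_self hs
    have h1 := hF.sum_mul_partialY_lagrangian hU (hg.mem s (hsub' hs')) he
    have h2 : ∀ m, partialY m (lagrangian F) (β s) (γ s) =
        θ' s * partialY m (lagrangian F) (β s) e := fun m => by
      rw [hγ s (hsub' hs'), hF.isHomogeneous_partialY_lagrangian hU m _ (hg.mem s (hsub' hs')) e he
        _ (hrs hs').1, pow_one]
    rw [eq_div_iff (mul_pos two_pos (hLpos s hs')).ne']
    simp only [h2]
    rw [lagrangian, ← h1, Finset.mul_sum]
    exact Finset.sum_congr rfl fun m _ => by ring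
  obtain ⟨ν, hν⟩ : ∃ ν, HasDerivAt θ' ν s₀ := by
    have h1 := HasDerivAt.fun_sum (u := Finset.univ) fun m _ => (hv m s₀ hs₀cd).const_mul (e m)
    have h2 := (hL.hasDerivAt_comp hU hβd (hasDerivAt_const s₀ e) hx he).const_mul 2
    exact ⟨_, (h1.fun_div h2 (mul_pos two_pos (hLpos s₀ hs₀c)).ne').congr_of_eventuallyEq hθeq⟩
  have hγd : HasDerivAt γ ((ν / θ' s₀) • γ s₀) s₀ := by
    have h1 : HasDerivAt (fun s => θ' s • e) (ν • e) s₀ := hν.smul_const e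
    have h2 : (ν / θ' s₀) • γ s₀ = ν • e := by
      rw [hγ s₀ (hsub' hs₀c), smul_smul, div_mul_cancel₀ _ hpos.ne']
    rw [h2]
    refine h1.congr_of_eventuallyEq ?_
    filter_upwards [Icc_mem_nhds hs₀.1 hs₀.2] with s hs using hγ s hs
  refine ⟨β s₀, hseg s₀ (hsub' hs₀c), hx, θ' s₀, hpos, -(ν / θ' s₀), fun m => ?_⟩
  rw [← hγ s₀ (hsub' hs₀c)]
  -- Two expressions for the derivative of `L_{y^m}`. The acceleration is a multiple of the
  -- velocity, so Euler's relation turns the second `y`-derivatives into a multiple of `L_{y^m}`.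
  have h1 := (hv m s₀ hs₀cd).unique ((hL.partialY hU m).hasDerivAt_comp hU hβd hγd hx hy)
  have e1 := (hF.isHomogeneous_partialY_lagrangian hU m).euler (hL.partialY hU m) hU hx hy
  simp only [PiLp.smul_apply, smul_eq_mul, mul_assoc, ← Finset.mul_sum] at h1
  rw [e1] at h1
  push_cast at h1
  rw [sprayDefect]
  linarith

/-- Euler's relation differentiated in `x`. Contraction with `y` identifies the multiplier: a defect
`μ L_{y^m}` must have `2 μ L = y^j L_{x^j}`. -/
theorem sum_mul_sprayDefect (hx : x ∈ U) (hy : y ≠ 0) :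
    ∑ m, y m * sprayDefect F m x y = ∑ j, y j * partialX j (lagrangian F) x y := by
  have hL := hF.isSmoothOffZero_lagrangian
  have h1 : ∀ j, ∑ m, y m * partialX j (partialY m (lagrangian F)) x y =
      2 * partialX j (lagrangian F) x y := by
    intro j
    have h := partialX_congr hU hx hy (f := fun x y => ∑ m, y m * partialY m (lagrangian F) x y)
      (g := fun x y => 2 * lagrangian F x y)
      (fun x hx y hy => hF.sum_mul_partialY_lagrangian hU hx hy) j
    rw [partialX_const_mul hU hx hy hL, partialX_sum hU hx hy
      (fun i _ => (IsSmoothOffZero.coord U i).mul (hL.partialY hU i))] at h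
    rw [← h]
    refine Finset.sum_congr rfl fun i _ => ?_
    rw [partialX_mul hU hx hy (IsSmoothOffZero.coord U i) (hL.partialY hU i), partialX_coord]
    ring
  have h2 : ∑ m, y m * ∑ j, y j * partialX j (partialY m (lagrangian F)) x y =
      ∑ j, y j * (2 * partialX j (lagrangian F) x y) := by
    simp only [← h1, Finset.mul_sum]
    rw [Finset.sum_comm]
    exact Finset.sum_congr rfl fun i _ => Finset.sum_congr rfl fun j _ => by ring
  simp only [sprayDefect, mul_sub, Finset.sum_sub_distrib]
  rw [h2, ← Finset.sum_sub_distrib]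
  exact Finset.sum_congr rfl fun j _ => by ring

theorem isSmoothOffZero_sprayDefect (m : Fin n) : IsSmoothOffZero U (sprayDefect F m) :=
  have hL := hF.isSmoothOffZero_lagrangian
  (IsSmoothOffZero.sum (s := Finset.univ) fun j _ => (IsSmoothOffZero.coord U j).mul
    ((hL.partialY hU m).partialX hU j)).sub (hL.partialX hU m)

theorem isHomogeneous_sprayDefect (m : Fin n) : IsHomogeneousOfDegree U 2 (sprayDefect F m) := by
  have hL := hF.isSmoothOffZero_lagrangian
  intro x hx y hy c hc
  have h1 := fun j => (hF.isHomogeneous_partialY_lagrangian hU m).partialX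
    (hL.partialY hU m) hU j x hx y hy c hc
  have h2 := hF.isHomogeneous_lagrangian.partialX hL hU m x hx y hy c hc
  simp only [sprayDefect, h1, h2, PiLp.smul_apply, smul_eq_mul, mul_sub, Finset.mul_sum]
  congr 1
  exact Finset.sum_congr rfl fun j _ => by ring

end IsStronglyConvex

/-- `y^j ∂F²/∂x^j`. -/
noncomputable def geodesicDerivative (F : Space n → Space n → ℝ) (x y : Space n) : ℝ :=
  ∑ j, y j * partialX j (lagrangian F) x y

/-- The projective factor `y^j ∂F²/∂x^j / (4 F²)`. -/
noncomputable def projectiveFactor (F : Space n → Space n → ℝ) (x y : Space n) : ℝ :=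
  geodesicDerivative F x y / (4 * lagrangian F x y)

namespace IsStronglyConvex

variable (hF : IsStronglyConvex U F) (hU : IsOpen U)
include hF hU

theorem isSmoothOffZero_geodesicDerivative : IsSmoothOffZero U (geodesicDerivative F) :=
  IsSmoothOffZero.sum (s := Finset.univ) fun j _ => (IsSmoothOffZero.coord U j).mul
    (hF.isSmoothOffZero_lagrangian.partialX hU j)

theorem isHomogeneous_geodesicDerivative : IsHomogeneousOfDegree U 3 (geodesicDerivative F) := by
  intro x hx y hy c hc
  have h2 := fun m => hF.isHomogeneous_lagrangian.partialX hF.isSmoothOffZero_lagrangian hU m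
    x hx y hy c hc
  simp only [geodesicDerivative, h2, PiLp.smul_apply, smul_eq_mul, Finset.mul_sum]
  exact Finset.sum_congr rfl fun j _ => by ring

theorem isSmoothOffZero_projectiveFactor : IsSmoothOffZero U (projectiveFactor F) :=
  (hF.isSmoothOffZero_geodesicDerivative hU).div (hF.isSmoothOffZero_lagrangian.const_mul 4)
    fun x hx y hy => (mul_pos four_pos (pow_pos (hF.pos x hx y hy) 2)).ne'

theorem isHomogeneous_projectiveFactor : IsHomogeneousOfDegree U 1 (projectiveFactor F) := by
  intro x hx y hy c hc
  have h1 := hF.isHomogeneous_geodesicDerivative hU x hx y hy c hc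
  have h2 := hF.isHomogeneous_lagrangian x hx y hy c hc
  have h3 : lagrangian F x y ≠ 0 := (pow_pos (hF.pos x hx y hy) 2).ne'
  rw [projectiveFactor, h1, h2, projectiveFactor]
  field_simp

theorem sprayDefect_of_isProjectivelyFlat (hflat : IsProjectivelyFlat U F) (hx : x ∈ U)
    (hy : y ≠ 0) (m : Fin n) :
    sprayDefect F m x y = 2 * projectiveFactor F x y * partialY m (lagrangian F) x y := by
  have hL := hF.isSmoothOffZero_lagrangian
  -- Euler's equation with the unknown multiplier eliminated. Since it is known only at some point
  -- of each segment, `Z ≠ 0` is spread to a ball and refuted on a short segment through `x` in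
  -- direction `y`.
  set Z : Space n → Space n → ℝ := fun x y => 2 * lagrangian F x y * sprayDefect F m x y -
    geodesicDerivative F x y * partialY m (lagrangian F) x y with hZ
  have hZs : IsSmoothOffZero U Z := ((hL.const_mul 2).mul (hF.isSmoothOffZero_sprayDefect hU m)).sub
    ((hF.isSmoothOffZero_geodesicDerivative hU).mul (hL.partialY hU m))
  have hLp : 0 < lagrangian F x y := pow_pos (hF.pos x hx y hy) 2
  suffices h : Z x y = 0 by
    rw [projectiveFactor]
    field_simp
    simp only [hZ] at h
    linarith
  by_contra hne
  have hev : ∀ᶠ z in 𝓝 x, Z z y ≠ 0 ∧ z ∈ U :=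
    ((hZs.continuousAt_fst hU hx hy).eventually_ne hne).and (hU.mem_nhds hx)
  obtain ⟨r, hr, hball⟩ := Metric.eventually_nhds_iff_ball.1 hev
  obtain ⟨τ, hτ, hτr⟩ : ∃ τ : ℝ, 0 < τ ∧ τ * ‖y‖ < r :=
    ⟨r / (2 * ‖y‖), by positivity, by field_simp; norm_num⟩
  have hmem : x + τ • y ∈ Metric.ball x r := by
    rw [mem_ball_iff_norm, add_sub_cancel_left, norm_smul, Real.norm_of_nonneg hτ.le]
    exact hτr
  have hseg : segment ℝ x (x + τ • y) ⊆ Metric.ball x r :=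
    (convex_ball x r).segment_subset (Metric.mem_ball_self hr) hmem
  have hτy : τ • y ≠ 0 := smul_ne_zero hτ.ne' hy
  obtain ⟨a, b, β, hab, hg, hbij, hβa, hβb⟩ := hflat x (x + τ • y) (by simpa using hτy)
    fun z hz => (hball z (hseg hz)).2
  obtain ⟨z, hz, hzU, κ, hκ, μ, hμ⟩ := hF.exists_sprayDefect_of_isGeodesic hU hab hg hτy
    hbij.mapsTo hβa hβb
  refine (hball z (hseg hz)).1 ?_
  have hκτ : 0 < κ * τ := mul_pos hκ hτ
  rw [smul_smul] at hμ
  set c := κ * τ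
  have hcy : c • y ≠ 0 := smul_ne_zero hκτ.ne' hy
  have h1 := hF.sum_mul_sprayDefect hU hzU hcy
  have h2 := hF.sum_mul_partialY_lagrangian hU hzU hcy
  have h3 : geodesicDerivative F z (c • y) = μ * (2 * lagrangian F z (c • y)) := by
    rw [geodesicDerivative, ← h1, lagrangian, ← h2, Finset.mul_sum]
    exact Finset.sum_congr rfl fun j _ => by rw [hμ]; ring
  have h4 : Z z (c • y) = 0 := by
    simp only [hZ, h3, hμ]
    ring
  have h5 : Z z (c • y) = c ^ 4 * Z z y := by
    simp only [hZ, hF.isHomogeneous_lagrangian z hzU y hy c hκτ,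
      hF.isHomogeneous_sprayDefect hU m z hzU y hy c hκτ,
      hF.isHomogeneous_geodesicDerivative hU z hzU y hy c hκτ,
      hF.isHomogeneous_partialY_lagrangian hU m z hzU y hy c hκτ]
    ring
  rw [h5] at h4
  exact (mul_eq_zero.1 h4).resolve_left (pow_pos hκτ 4).ne'

end IsStronglyConvex

end

section

variable {n : ℕ} {U : Set (Space n)} {F : Space n → Space n → ℝ} {x y p q : Space n}

/-! ### Geodesics of a smooth Hilbert metric -/

/-- The affine parameter `(e^{2s} - 1) / (b + a e^{2s})` of a unit speed geodesic of the Hilbert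
metric. -/
noncomputable def hilbertParam (a b s : ℝ) : ℝ :=
  (Real.exp (2 * s) - 1) / (b + a * Real.exp (2 * s))

/-- The derivative of `hilbertParam`. -/
noncomputable def hilbertSpeed (a b s : ℝ) : ℝ :=
  2 * (a + b) * Real.exp (2 * s) / (b + a * Real.exp (2 * s)) ^ 2

section param

variable {a b : ℝ} (ha : 0 < a) (hb : 0 < b) (s : ℝ)
include ha hb

theorem hilbertSpeed_pos : 0 < hilbertSpeed a b s := by
  unfold hilbertSpeed
  positivity

theorem hasDerivAt_hilbertParam : HasDerivAt (hilbertParam a b) (hilbertSpeed a b s) s := by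
  have hE : HasDerivAt (fun s : ℝ => Real.exp (2 * s)) (Real.exp (2 * s) * 2) s := by
    simpa using ((hasDerivAt_id s).const_mul 2).exp
  have hD : 0 < b + a * Real.exp (2 * s) := by positivity
  refine ((hE.sub_const 1).fun_div ((hE.const_mul a).const_add b) hD.ne').congr_deriv ?_
  unfold hilbertSpeed
  field_simp
  ring

theorem hasDerivAt_hilbertSpeed : HasDerivAt (hilbertSpeed a b)
    (hilbertSpeed a b s * (2 * (b - a * Real.exp (2 * s)) / (b + a * Real.exp (2 * s)))) s := by
  have hE : HasDerivAt (fun s : ℝ => Real.exp (2 * s)) (Real.exp (2 * s) * 2) s := by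
    simpa using ((hasDerivAt_id s).const_mul 2).exp
  have hD : 0 < b + a * Real.exp (2 * s) := by positivity
  refine ((hE.const_mul (2 * (a + b))).fun_div (((hE.const_mul a).const_add b).fun_pow 2)
    (pow_pos hD 2).ne').congr_deriv ?_
  unfold hilbertSpeed
  field_simp
  ring

theorem strictMono_hilbertParam : StrictMono (hilbertParam a b) :=
  strictMono_of_hasDerivAt_pos (hasDerivAt_hilbertParam ha hb) (hilbertSpeed_pos ha hb)

/-- The parameter solves `exp (2 s) = (1 + b t) / (1 - a t)`, i.e. `s` is Hilbert arc length. The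
left side is the projective factor along the curve, the right side `-1/2` times the logarithmic
derivative of the speed, so `γ' = -2 P γ`. -/
theorem hilbertParam_relation :
    hilbertSpeed a b s * (1 / 2 * (a / (1 - a * hilbertParam a b s) -
      b / (1 + b * hilbertParam a b s))) =
      (a * Real.exp (2 * s) - b) / (b + a * Real.exp (2 * s)) := by
  have hD : 0 < b + a * Real.exp (2 * s) := by positivity
  have h1 : 1 - a * hilbertParam a b s = (a + b) / (b + a * Real.exp (2 * s)) := by
    unfold hilbertParam
    field_simp
    ring
  have h2 : 1 + b * hilbertParam a b s =
      (a + b) * Real.exp (2 * s) / (b + a * Real.exp (2 * s)) := by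
    unfold hilbertParam
    field_simp
    ring
  rw [h1, h2]
  unfold hilbertSpeed
  field_simp

end param

theorem IsStronglyConvex.isProjectivelyFlat_of_hilbert (hF : IsStronglyConvex U F) (hU : IsOpen U)
    (hconv : Convex ℝ U) (hbdd : Bornology.IsBounded U)
    (hH : ∀ x ∈ U, ∀ ξ : Space n, F x ξ = hilbertMetric U x ξ) : IsProjectivelyFlat U F := by
  intro p q hpq hseg
  have hp : p ∈ U := hseg (left_mem_segment ℝ p q)
  have hq : q ∈ U := hseg (right_mem_segment ℝ p q)
  have he : q - p ≠ 0 := sub_ne_zero.2 hpq.symm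
  set e := q - p with hedef
  have ha := funkMetric_pos hU hp hbdd he
  have hb := funkMetric_pos hU hp hbdd (neg_ne_zero.2 he)
  have ha1 : funkMetric U p e * 1 < 1 :=
    funkMetric_mul_lt_one hU hp hconv (by rw [one_smul, hedef, add_sub_cancel]; exact hq)
  rw [mul_one] at ha1
  have hfac : ∀ t : ℝ, p + t • e ∈ U → hilbertFactor U (p + t • e) e =
      1 / 2 * (funkMetric U p e / (1 - funkMetric U p e * t) -
        funkMetric U p (-e) / (1 + funkMetric U p (-e) * t)) := by
    intro t ht
    have ht' : p + (-t) • (-e) ∈ U := by simpa using ht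
    have := funkMetric_line hU hp hconv hbdd (neg_ne_zero.2 he) ht'
    rw [neg_smul_neg, mul_neg, sub_neg_eq_add] at this
    rw [hilbertFactor, this, funkMetric_line hU hp hconv hbdd he ht]
  set a := funkMetric U p e
  set b := funkMetric U p (-e)
  have hab1 : 1 < (1 + b) / (1 - a) := by
    rw [lt_div_iff₀ (by linarith)]
    linarith
  -- The Hilbert length of the segment, at which the affine parameter reaches `1`.
  set l : ℝ := Real.log ((1 + b) / (1 - a)) / 2 with hl
  have hlpos : 0 < l := half_pos (Real.log_pos hab1)
  have hmono := strictMono_hilbertParam ha hb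
  have h0 : hilbertParam a b 0 = 0 := by simp [hilbertParam]
  have h1 : hilbertParam a b l = 1 := by
    have : Real.exp (2 * l) = (1 + b) / (1 - a) := by
      rw [hl, mul_div_cancel₀ _ two_ne_zero, Real.exp_log (by linarith)]
    have h1a : 1 - a ≠ 0 := by linarith
    have h3 : b + a * ((1 + b) / (1 - a)) ≠ 0 := by
      have := mul_pos ha (zero_lt_one.trans hab1)
      linarith
    rw [hilbertParam, this, div_eq_one_iff_eq h3]
    field_simp
    ring
  have hcont : Continuous (hilbertParam a b) :=
    continuous_iff_continuousAt.2 fun s => (hasDerivAt_hilbertParam ha hb s).continuousAt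
  set β : ℝ → Space n := fun s => p + hilbertParam a b s • e with hβ
  set γ : ℝ → Space n := fun s => hilbertSpeed a b s • e with hγ
  have hmaps : MapsTo β (Icc 0 l) (segment ℝ p q) := by
    intro s hs
    rw [segment_eq_image']
    exact ⟨hilbertParam a b s, ⟨h0 ▸ hmono.monotone hs.1, h1 ▸ hmono.monotone hs.2⟩, rfl⟩
  have hβd : ∀ s, HasDerivAt β (γ s) s := fun s =>
    ((hasDerivAt_hilbertParam ha hb s).smul_const e).const_add p
  have hγd : ∀ s, HasDerivAt γ ((hilbertSpeed a b s *
      (2 * (b - a * Real.exp (2 * s)) / (b + a * Real.exp (2 * s)))) • e) s := fun s =>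
    (hasDerivAt_hilbertSpeed ha hb s).smul_const e
  have hγc : Continuous γ := continuous_iff_continuousAt.2 fun s => (hγd s).continuousAt
  refine ⟨0, l, β, hlpos, ?_, ⟨hmaps, ?_, ?_⟩, by simp [hβ, h0], by simp [hβ, h1, hedef]⟩
  · refine hF.isGeodesic_of_hasDerivAt hU (P := hilbertFactor U)
      (fun x hx y hy m => hF.sprayDefect_of_hilbert hU hconv hbdd hH hx hy m) hlpos
      (γ := γ) ?_ (fun s _ => hβd s) ?_ (fun s hs => hseg (hmaps hs))
      (fun s _ => smul_ne_zero (hilbertSpeed_pos ha hb s).ne' he)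
    · refine ContDiff.contDiffOn (contDiff_one_iff_deriv.2 ⟨fun s => (hβd s).differentiableAt, ?_⟩)
      rwa [funext fun s => (hβd s).deriv]
    · intro s hs
      have hsU := hseg (hmaps hs)
      refine (hγd s).congr_deriv ?_
      have h2 := IsStronglyConvex.isHomogeneous_hilbertFactor U (β s) hsU e he _
        (hilbertSpeed_pos ha hb s)
      rw [pow_one, hfac _ hsU, hilbertParam_relation ha hb] at h2
      simp only [hγ]
      rw [h2, smul_smul]
      congr 1
      ring
  · intro s _ t _ hst
    simp only [hβ, add_right_inj] at hst
    exact hmono.injective (smul_left_injective ℝ he hst)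
  · intro z hz
    rw [segment_eq_image'] at hz
    obtain ⟨t, ht, rfl⟩ := hz
    obtain ⟨s, hs, rfl⟩ := intermediate_value_Icc hlpos.le hcont.continuousOn
      (show t ∈ Icc (hilbertParam a b 0) (hilbertParam a b l) by rwa [h0, h1])
    exact ⟨s, hs, rfl⟩

/-! ### Estimates of the distance -/

namespace IsFinslerMetric

variable (hF : IsFinslerMetric U F)
include hF

theorem nonneg (hx : x ∈ U) (ξ : Space n) : 0 ≤ F x ξ := by
  rcases eq_or_ne ξ 0 with rfl | h
  · have := hF.smul x hx 0 le_rfl 0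
    simp only [zero_smul, zero_mul] at this
    exact this.ge
  · exact (hF.pos x hx ξ h).le

theorem apply_zero (hx : x ∈ U) : F x 0 = 0 := by
  simpa using hF.smul x hx 0 le_rfl 0

/-- The straight segment at constant velocity is a competitor; lengths are bounded below by `0`, as
the infimum requires. -/
theorem finslerDist_le {M : ℝ} (hseg : segment ℝ p q ⊆ U)
    (hM : ∀ x ∈ segment ℝ p q, F x (q - p) ≤ M) : finslerDist U F p q ≤ M := by
  set β : ℝ → Space n := fun s => p + s • (q - p) with hβ
  have hmem : ∀ s ∈ Icc (0 : ℝ) 1, β s ∈ segment ℝ p q := fun s hs => by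
    rw [segment_eq_image']
    exact ⟨s, hs, rfl⟩
  have hd : ∀ s ∈ Icc (0 : ℝ) 1, derivWithin β (Icc 0 1) s = q - p := fun s hs => by
    have h := ((hasDerivAt_id s).smul_const (q - p)).const_add p
    rw [one_smul] at h
    exact h.hasDerivWithinAt.derivWithin (uniqueDiffOn_Icc zero_lt_one s hs)
  have hle : length F 0 1 β ≤ M := by
    have h1 : ‖∫ s in (0 : ℝ)..1, F (β s) (derivWithin β (Icc 0 1) s)‖ ≤ M * |1 - 0| := by
      refine intervalIntegral.norm_integral_le_of_norm_le_const fun s hs => ?_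
      rw [uIoc_of_le zero_le_one] at hs
      have hs' := Ioc_subset_Icc_self hs
      rw [hd s hs', Real.norm_of_nonneg (hF.nonneg (hseg (hmem s hs')) _)]
      exact hM _ (hmem s hs')
    simp only [sub_zero, abs_one, mul_one] at h1
    exact (le_abs_self _).trans h1
  refine (csInf_le ⟨0, ?_⟩ ?_).trans hle
  · rintro _ ⟨η, -, hη, -, -, rfl⟩
    exact intervalIntegral.integral_nonneg zero_le_one fun s hs => hF.nonneg (hη s hs) _
  · refine ⟨β, ?_, fun s hs => hseg (hmem s hs), by simp [hβ], by simp [hβ], rfl⟩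
    have : ContDiff ℝ ∞ β := by fun_prop
    exact this.contDiffOn

/-- The change of `ψ` along any curve is the integral of `ψ' (β')`, at most `C` times the length.
Convexity supplies one admissible curve, since the real infimum of the empty set would be `0`. -/
theorem sub_le_mul_finslerDist (hconv : Convex ℝ U) (hp : p ∈ U) (hq : q ∈ U) {C : ℝ} (hC : 0 < C)
    {ψ : Space n → ℝ} {ψ' : Space n → Space n →L[ℝ] ℝ} (hψ : ∀ x ∈ U, HasFDerivAt ψ (ψ' x) x)
    (hb : ∀ x ∈ U, ∀ ξ, ψ' x ξ ≤ C * F x ξ) : ψ q - ψ p ≤ C * finslerDist U F p q := by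
  rw [← div_le_iff₀' hC]
  refine le_csInf ?_ ?_
  · set β : ℝ → Space n := fun s => p + s • (q - p) with hβ
    have : ContDiff ℝ ∞ β := by fun_prop
    refine ⟨_, β, this.contDiffOn, fun s hs => ?_, by simp [hβ], by simp [hβ], rfl⟩
    refine hconv.segment_subset hp hq ?_
    rw [segment_eq_image']
    exact ⟨s, hs, rfl⟩
  · rintro _ ⟨β, hβ, hmem, rfl, rfl, rfl⟩
    have hud := uniqueDiffOn_Icc (zero_lt_one (α := ℝ))
    rw [div_le_iff₀' hC, length, ← intervalIntegral.integral_const_mul]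
    have hc : ContinuousOn (fun s => C * F (β s) (derivWithin β (Icc 0 1) s)) (Icc 0 1) :=
      continuousOn_const.mul (hF.continuousOn.comp (hβ.continuousOn.prodMk
        (hβ.continuousOn_derivWithin hud (by simp))) fun s hs => ⟨hmem s hs, mem_univ _⟩)
    refine intervalIntegral.sub_le_integral_of_hasDeriv_right_of_le zero_le_one
      (g := fun s => ψ (β s)) (g' := fun s => ψ' (β s) (derivWithin β (Icc 0 1) s)) ?_ ?_ ?_ ?_
    · exact fun s hs => (hψ _ (hmem s hs)).continuousAt.comp_continuousWithinAt
        (hβ.continuousOn s hs)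
    · intro s hs
      have hs' := Ioo_subset_Icc_self hs
      have h1 : HasDerivAt β (derivWithin β (Icc 0 1) s) s :=
        ((hβ.differentiableOn (by simp)) s hs').hasDerivWithinAt.hasDerivAt
          (Icc_mem_nhds hs.1 hs.2)
      exact ((hψ _ (hmem s hs')).comp_hasDerivAt s h1).hasDerivWithinAt
    · exact hc.integrableOn_Icc
    · exact fun s hs => hb _ (hmem s (Ioo_subset_Icc_self hs)) _

theorem abs_sub_le_mul_finslerDist (hconv : Convex ℝ U) (hp : p ∈ U) (hq : q ∈ U) {C : ℝ}
    (hC : 0 < C) {ψ : Space n → ℝ} {ψ' : Space n → Space n →L[ℝ] ℝ}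
    (hψ : ∀ x ∈ U, HasFDerivAt ψ (ψ' x) x) (hb : ∀ x ∈ U, ∀ ξ, |ψ' x ξ| ≤ C * F x ξ) :
    |ψ q - ψ p| ≤ C * finslerDist U F p q := by
  have h1 := hF.sub_le_mul_finslerDist hconv hp hq hC hψ fun x hx ξ =>
    (le_abs_self _).trans (hb x hx ξ)
  have h2 := hF.sub_le_mul_finslerDist hconv hp hq hC (fun x hx => (hψ x hx).neg) fun x hx ξ =>
    (neg_le_abs _).trans (hb x hx ξ)
  simp only [Pi.neg_apply] at h2
  exact abs_le.2 ⟨by linarith, h1⟩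

end IsFinslerMetric

/-! ### Completeness of the Hilbert metric -/

section completeness

variable (hU : IsOpen U) (hconv : Convex ℝ U) (hbdd : Bornology.IsBounded U)
include hU hconv hbdd

theorem add_inv_funkMetric_smul_mem_closure (hx : x ∈ U) (hy : y ≠ 0) :
    x + (funkMetric U x y)⁻¹ • y ∈ closure U := by
  have hα := funkMetric_pos hU hx hbdd hy
  refine frontier_subset_closure ((funkMetric_eq_one_iff hU hx hconv).1 ?_)
  rw [funkMetric_smul _ _ _ (inv_nonneg.2 hα.le), inv_mul_cancel₀ hα.ne']

/-- The exit point `x + ξ / funkMetric U x ξ` lies in the closure of `U`, hence in the half-space `f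
≤ c`. -/
theorem apply_le_mul_funkMetric (hx : x ∈ U) {f : Space n →L[ℝ] ℝ} {c : ℝ}
    (hf : ∀ z ∈ U, f z < c) (ξ : Space n) : f ξ ≤ (c - f x) * funkMetric U x ξ := by
  rcases eq_or_ne ξ 0 with rfl | h
  · simp [funkMetric_zero]
  · have hα := funkMetric_pos hU hx hbdd h
    have h1 : f (x + (funkMetric U x ξ)⁻¹ • ξ) ≤ c :=
      closure_minimal (fun z hz => (hf z hz).le) (isClosed_le f.continuous continuous_const)
        (add_inv_funkMetric_smul_mem_closure hU hconv hbdd hx h)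
    rw [map_add, map_smul, smul_eq_mul] at h1
    rw [← div_le_iff₀ hα, div_eq_inv_mul]
    linarith

theorem norm_le_mul_funkMetric (hx : x ∈ U) {C : ℝ} (hC : ∀ z ∈ U, ‖z‖ ≤ C) (ξ : Space n) :
    ‖ξ‖ ≤ 2 * C * funkMetric U x ξ := by
  rcases eq_or_ne ξ 0 with rfl | h
  · simp [funkMetric_zero]
  · have hα := funkMetric_pos hU hx hbdd h
    have h1 : ‖x + (funkMetric U x ξ)⁻¹ • ξ‖ ≤ C :=
      closure_minimal (fun z hz => hC z hz) (isClosed_le continuous_norm continuous_const)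
        (add_inv_funkMetric_smul_mem_closure hU hconv hbdd hx h)
    have h2 : ‖(funkMetric U x ξ)⁻¹ • ξ‖ ≤ ‖x + (funkMetric U x ξ)⁻¹ • ξ‖ + ‖x‖ := by
      simpa using norm_sub_le (x + (funkMetric U x ξ)⁻¹ • ξ) x
    rw [norm_smul, Real.norm_of_nonneg (inv_nonneg.2 hα.le)] at h2
    rw [← div_le_iff₀ hα, div_eq_inv_mul]
    linarith [hC x hx]

/-- Forward and backward Cauchy sequences are treated together: `F` dominates half of both Funk
metrics, so all Lipschitz bounds hold in either direction. The metric dominates the norm, giving a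
Euclidean limit; a logarithmic barrier keeps that limit inside `U`. -/
theorem IsFinslerMetric.exists_tendsto_of_hilbert (hF : IsFinslerMetric U F)
    (hH : ∀ x ∈ U, ∀ ξ : Space n, F x ξ = hilbertMetric U x ξ) {u : ℕ → Space n}
    (hu : ∀ i, u i ∈ U)
    (hcau : ∀ ε : ℝ, 0 < ε → ∃ N : ℕ, ∀ k,
      finslerDist U F (u N) (u (N + k)) < ε ∨ finslerDist U F (u (N + k)) (u N) < ε) :
    ∃ z ∈ U, Tendsto u atTop (𝓝 z) := by
  have hpos : ∀ x ∈ U, ∀ ξ, 0 ≤ funkMetric U x ξ := fun x _ ξ => by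
    rw [funkMetric_eq_gauge]
    exact gauge_nonneg _
  have hle : ∀ x ∈ U, ∀ ξ, funkMetric U x ξ ≤ 2 * F x ξ ∧ funkMetric U x (-ξ) ≤ 2 * F x ξ := by
    intro x hx ξ
    have h1 := hpos x hx ξ
    have h2 := hpos x hx (-ξ)
    rw [hH x hx, hilbertMetric]
    constructor <;> linarith
  have hest : ∀ {C : ℝ} (_ : 0 < C) {ψ : Space n → ℝ} {ψ' : Space n → Space n →L[ℝ] ℝ}
      (_ : ∀ x ∈ U, HasFDerivAt ψ (ψ' x) x) (_ : ∀ x ∈ U, ∀ ξ, |ψ' x ξ| ≤ C * F x ξ),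
      ∀ ε > 0, ∃ N, ∀ k, |ψ (u (N + k)) - ψ (u N)| ≤ C * ε := by
    intro C hC ψ ψ' hψ hb ε hε
    obtain ⟨N, hN⟩ := hcau ε hε
    refine ⟨N, fun k => ?_⟩
    rcases hN k with h | h
    · exact (hF.abs_sub_le_mul_finslerDist hconv (hu _) (hu _) hC hψ hb).trans (by gcongr)
    · rw [abs_sub_comm]
      exact (hF.abs_sub_le_mul_finslerDist hconv (hu _) (hu _) hC hψ hb).trans (by gcongr)
  obtain ⟨C, hC⟩ := hbdd.exists_norm_le
  set D := |C| + 1 with hD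
  have hDpos : 0 < D := by positivity
  have hnorm : ∀ x ∈ U, ∀ ξ, ‖ξ‖ ≤ 4 * D * F x ξ := fun x hx ξ => by
    have h1 := norm_le_mul_funkMetric hU hconv hbdd hx
      (fun z hz => (hC z hz).trans ((le_abs_self C).trans (by linarith : |C| ≤ D))) ξ
    refine h1.trans ?_
    have := mul_le_mul_of_nonneg_left (hle x hx ξ).1 (by positivity : 0 ≤ 2 * D)
    linarith
  have hcauchy : CauchySeq u := by
    rw [Metric.cauchySeq_iff']
    intro ε hε
    obtain ⟨N, hN⟩ := hcau (ε / (4 * D)) (by positivity)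
    refine ⟨N, fun i hi => ?_⟩
    obtain ⟨k, rfl⟩ := Nat.exists_eq_add_of_le hi
    have key : ∀ p ∈ U, ∀ q ∈ U, ‖q - p‖ ≤ 4 * D * finslerDist U F p q := by
      intro p hp q hq
      rcases eq_or_ne (q - p) 0 with h0 | h0
      · have h2 := hF.abs_sub_le_mul_finslerDist hconv hp hq (C := 4 * D) (by positivity)
          (ψ := fun _ => 0) (ψ' := fun _ => 0) (fun x _ => hasFDerivAt_const _ _)
          (fun x hx ξ => by simpa using mul_nonneg (by positivity) (hF.nonneg hx ξ))
        simpa [h0] using h2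
      · have hv : 0 < ‖q - p‖ := norm_pos_iff.2 h0
        have h2 := hF.abs_sub_le_mul_finslerDist hconv hp hq (C := ‖q - p‖ * (4 * D))
          (by positivity) (ψ := fun z => innerSL ℝ (q - p) z) (ψ' := fun _ => innerSL ℝ (q - p))
          (fun x _ => (innerSL ℝ (q - p)).hasFDerivAt)
          (fun x hx ξ => by
            rw [innerSL_apply_apply, mul_assoc]
            exact (abs_real_inner_le_norm _ _).trans
              (mul_le_mul_of_nonneg_left (hnorm x hx ξ) hv.le))
        simp only [innerSL_apply_apply] at h2
        rw [← inner_sub_right, real_inner_self_eq_norm_sq, abs_of_nonneg (by positivity), sq,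
          mul_assoc] at h2
        exact le_of_mul_le_mul_left h2 hv
    rcases hN k with h | h
    · rw [dist_eq_norm]
      refine (key _ (hu N) _ (hu (N + k))).trans_lt ?_
      rwa [lt_div_iff₀' (by positivity)] at h
    · rw [dist_eq_norm, norm_sub_rev]
      refine (key _ (hu (N + k)) _ (hu N)).trans_lt ?_
      rwa [lt_div_iff₀' (by positivity)] at h
  obtain ⟨z, hz⟩ := cauchySeq_tendsto_of_complete hcauchy
  refine ⟨z, ?_, hz⟩
  by_contra hzU
  obtain ⟨f, hf⟩ := geometric_hahn_banach_open_point hconv hU hzU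
  -- The barrier at a limit outside `U`: it varies by at most twice the distance, so `f z - f (u i)`
  -- stays above a positive constant, although it tends to `0`.
  have hψ : ∀ x ∈ U, HasFDerivAt (fun x => Real.log (f z - f x)) ((f z - f x)⁻¹ • (-f)) x :=
    fun x hx => (f.hasFDerivAt.const_sub (f z)).log (sub_pos.2 (hf x hx)).ne'
  obtain ⟨N, hN⟩ := hest two_pos hψ (fun x hx ξ => by
    have hpos := sub_pos.2 (hf x hx)
    have h1 := apply_le_mul_funkMetric hU hconv hbdd hx hf ξ
    have h2 := apply_le_mul_funkMetric hU hconv hbdd hx hf (-ξ)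
    have h3 := hle x hx ξ
    simp only [_root_.smul_apply, _root_.neg_apply, smul_eq_mul]
    rw [abs_mul, abs_neg, abs_of_pos (inv_pos.2 hpos), inv_mul_le_iff₀ hpos, abs_le]
    rw [map_neg] at h2
    have h4 := mul_le_mul_of_nonneg_left h3.1 hpos.le
    have h5 := mul_le_mul_of_nonneg_left h3.2 hpos.le
    constructor <;> linarith) 1 one_pos
  set m := Real.log (f z - f (u N)) - 2 with hm
  have hlow : ∀ k, Real.exp m ≤ f z - f (u (N + k)) := fun k => by
    rw [← Real.le_log_iff_exp_le (sub_pos.2 (hf _ (hu _)))]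
    have := (abs_le.1 (hN k)).1
    linarith
  have hlim : Tendsto (fun k => f z - f (u (N + k))) atTop (𝓝 (f z - f z)) := by
    refine tendsto_const_nhds.sub ((f.continuous.tendsto z).comp ?_)
    exact hz.comp (tendsto_add_atTop_nat N |>.congr fun k => add_comm k N)
  have h6 := ge_of_tendsto' hlim hlow
  rw [sub_self] at h6
  exact h6.not_gt (Real.exp_pos m)

theorem IsFinslerMetric.isComplete_of_hilbert (hF : IsFinslerMetric U F)
    (hH : ∀ x ∈ U, ∀ ξ : Space n, F x ξ = hilbertMetric U x ξ) : IsComplete U F := by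
  refine ⟨fun u hu hcau => ?_, fun u hu hcau => ?_⟩ <;>
  refine hF.exists_tendsto_of_hilbert hU hconv hbdd hH hu fun ε hε => ?_ <;>
  obtain ⟨N, hN⟩ := hcau ε hε
  · exact ⟨N, fun k => Or.inl (hN N le_rfl k)⟩
  · exact ⟨N, fun k => Or.inr (hN N le_rfl k)⟩

end completeness

end

section

variable {n : ℕ} {U : Set (Space n)} {F : Space n → Space n → ℝ} {x y : Space n}

/-! ### Completeness and unboundedness along lines -/

theorem exists_tendsto_of_ray (a : ℝ) (ha : 0 < a) :
    ∃ t : ℕ → ℝ, Monotone t ∧ (∀ i, 0 ≤ t i ∧ t i < a) ∧ Tendsto t atTop (𝓝 a) := by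
  have hlim : Tendsto (fun i : ℕ => a * (1 - 1 / ((i : ℝ) + 1))) atTop (𝓝 a) := by
    simpa using (tendsto_one_div_add_atTop_nhds_zero_nat.const_sub (1 : ℝ)).const_mul a
  refine ⟨_, fun i j hij => ?_, fun i => ⟨?_, ?_⟩, hlim⟩
  · exact mul_le_mul_of_nonneg_left
      (sub_le_sub_left (one_div_le_one_div_of_le (by positivity) (by gcongr)) _) ha.le
  · refine mul_nonneg ha.le (sub_nonneg.2 ?_)
    rw [div_le_one (by positivity)]
    linarith [(Nat.cast_nonneg i : (0 : ℝ) ≤ i)]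
  · have : (0 : ℝ) < 1 / ((i : ℝ) + 1) := by positivity
    nlinarith

namespace IsFinslerMetric

variable (hF : IsFinslerMetric U F) (hU : IsOpen U) (hconv : Convex ℝ U)
  (hbdd : Bornology.IsBounded U) (hx : x ∈ U) (hy : y ≠ 0) {M : ℝ}
include hF hU hconv hbdd hx hy

theorem finslerDist_ray_le
    (hM : ∀ t, 0 ≤ t → funkMetric U x y * t < 1 → F (x + t • y) y ≤ M) {s t : ℝ} (hs : 0 ≤ s)
    (hst : s ≤ t) (ht : funkMetric U x y * t < 1) :
    finslerDist U F (x + s • y) (x + t • y) ≤ (t - s) * M := by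
  have hα := funkMetric_pos hU hx hbdd hy
  have hmem : ∀ r, 0 ≤ r → r ≤ t → funkMetric U x y * r < 1 := fun r _ hr =>
    (mul_le_mul_of_nonneg_left hr hα.le).trans_lt ht
  have he : x + t • y - (x + s • y) = (t - s) • y := by module
  have hseg : ∀ z ∈ segment ℝ (x + s • y) (x + t • y), ∃ r, 0 ≤ r ∧ r ≤ t ∧ z = x + r • y := by
    intro z hz
    rw [segment_eq_image', he] at hz
    obtain ⟨τ, hτ, rfl⟩ := hz
    refine ⟨s + τ * (t - s), ?_, ?_, by module⟩
    · exact add_nonneg hs (mul_nonneg hτ.1 (sub_nonneg.2 hst))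
    · nlinarith [hτ.2]
  refine hF.finslerDist_le (fun z hz => ?_) fun z hz => ?_
  · obtain ⟨r, h0, h1, rfl⟩ := hseg z hz
    exact add_smul_mem_of_lt hU hx hconv h0 (hmem r h0 h1)
  · obtain ⟨r, h0, h1, rfl⟩ := hseg z hz
    rw [he, hF.smul _ (add_smul_mem_of_lt hU hx hconv h0 (hmem r h0 h1)) _ (sub_nonneg.2 hst)]
    exact mul_le_mul_of_nonneg_left (hM r h0 (hmem r h0 h1)) (sub_nonneg.2 hst)

/-- `F` is not assumed reversible, so distances back along the ray are governed by the speed of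
`-y`. -/
theorem finslerDist_ray_neg_le
    (hM : ∀ t, 0 ≤ t → funkMetric U x y * t < 1 → F (x + t • y) (-y) ≤ M) {s t : ℝ} (hs : 0 ≤ s)
    (hst : s ≤ t) (ht : funkMetric U x y * t < 1) :
    finslerDist U F (x + t • y) (x + s • y) ≤ (t - s) * M := by
  have hα := funkMetric_pos hU hx hbdd hy
  have hmem : ∀ r, 0 ≤ r → r ≤ t → funkMetric U x y * r < 1 := fun r _ hr =>
    (mul_le_mul_of_nonneg_left hr hα.le).trans_lt ht
  have he : x + s • y - (x + t • y) = (t - s) • (-y) := by module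
  have hseg : ∀ z ∈ segment ℝ (x + t • y) (x + s • y), ∃ r, 0 ≤ r ∧ r ≤ t ∧ z = x + r • y := by
    intro z hz
    rw [segment_eq_image', he] at hz
    obtain ⟨τ, hτ, rfl⟩ := hz
    refine ⟨t - τ * (t - s), ?_, ?_, by module⟩
    · nlinarith [hτ.2]
    · exact sub_le_self _ (mul_nonneg hτ.1 (sub_nonneg.2 hst))
  refine hF.finslerDist_le (fun z hz => ?_) fun z hz => ?_
  · obtain ⟨r, h0, h1, rfl⟩ := hseg z hz
    exact add_smul_mem_of_lt hU hx hconv h0 (hmem r h0 h1)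
  · obtain ⟨r, h0, h1, rfl⟩ := hseg z hz
    rw [he, hF.smul _ (add_smul_mem_of_lt hU hx hconv h0 (hmem r h0 h1)) _ (sub_nonneg.2 hst)]
    exact mul_le_mul_of_nonneg_left (hM r h0 (hmem r h0 h1)) (sub_nonneg.2 hst)

omit hF in
/-- A sequence on a ray that runs to the boundary has no limit in `U`; it is Cauchy if the distances
are at most proportional to the parameter. -/
theorem exists_divergent_sequence (M : ℝ) :
    ∃ t : ℕ → ℝ, Monotone t ∧ (∀ i, 0 ≤ t i ∧ funkMetric U x y * t i < 1) ∧
      (∀ ε : ℝ, 0 < ε → ∃ N : ℕ, ∀ i, N ≤ i → ∀ k, (t (i + k) - t i) * M < ε) ∧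
      ¬∃ z ∈ U, Tendsto (fun i => x + t i • y) atTop (𝓝 z) := by
  have hα := funkMetric_pos hU hx hbdd hy
  obtain ⟨t, hmono, ht, hlim⟩ := exists_tendsto_of_ray _ (inv_pos.2 hα)
  refine ⟨t, hmono, fun i => ⟨(ht i).1, ?_⟩, fun ε hε => ?_, ?_⟩
  · have := mul_lt_mul_of_pos_left (ht i).2 hα
    rwa [mul_inv_cancel₀ hα.ne'] at this
  · obtain ⟨N, hN⟩ := Metric.cauchySeq_iff.1 hlim.cauchySeq (ε / (|M| + 1)) (by positivity)
    refine ⟨N, fun i hi k => ?_⟩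
    have h1 := hN (i + k) (by omega) i hi
    rw [Real.dist_eq, lt_div_iff₀ (by positivity)] at h1
    refine lt_of_le_of_lt ?_ h1
    calc (t (i + k) - t i) * M ≤ |(t (i + k) - t i) * M| := le_abs_self _
      _ = |t (i + k) - t i| * |M| := abs_mul _ _
      _ ≤ _ := by gcongr; linarith
  · rintro ⟨z, hz, hzlim⟩
    have h1 : Tendsto (fun i => x + t i • y) atTop (𝓝 (x + (funkMetric U x y)⁻¹ • y)) :=
      (hlim.smul_const y).const_add x
    rw [tendsto_nhds_unique hzlim h1, ← funkMetric_lt_one_iff hU hx hconv,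
      funkMetric_smul _ _ _ (inv_nonneg.2 hα.le), inv_mul_cancel₀ hα.ne'] at hz
    exact lt_irrefl _ hz

/-- With bounded speed, points running to the boundary would form a forward Cauchy sequence without
a limit in `U`. -/
theorem not_bounded_of_isForwardComplete (hc : IsForwardComplete U F) :
    ¬∃ M, ∀ t, 0 ≤ t → funkMetric U x y * t < 1 → F (x + t • y) y ≤ M := by
  rintro ⟨M, hM⟩
  obtain ⟨t, hmono, ht, hcau, hdiv⟩ := exists_divergent_sequence hU hconv hbdd hx hy M
  refine hdiv (hc _ (fun i => add_smul_mem_of_lt hU hx hconv (ht i).1 (ht i).2) fun ε hε => ?_)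
  obtain ⟨N, hN⟩ := hcau ε hε
  exact ⟨N, fun i hi k => (hF.finslerDist_ray_le hU hconv hbdd hx hy hM (ht i).1
    (hmono (Nat.le_add_right i k)) (ht _).2).trans_lt (hN i hi k)⟩

theorem not_bounded_of_isBackwardComplete (hc : IsBackwardComplete U F) :
    ¬∃ M, ∀ t, 0 ≤ t → funkMetric U x y * t < 1 → F (x + t • y) (-y) ≤ M := by
  rintro ⟨M, hM⟩
  obtain ⟨t, hmono, ht, hcau, hdiv⟩ := exists_divergent_sequence hU hconv hbdd hx hy M
  refine hdiv (hc _ (fun i => add_smul_mem_of_lt hU hx hconv (ht i).1 (ht i).2) fun ε hε => ?_)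
  obtain ⟨N, hN⟩ := hcau ε hε
  exact ⟨N, fun i hi k => (hF.finslerDist_ray_neg_le hU hconv hbdd hx hy hM (ht i).1
    (hmono (Nat.le_add_right i k)) (ht _).2).trans_lt (hN i hi k)⟩

end IsFinslerMetric

/-! ### The metric along a line -/

/-- The solution of `f' = 2 p f`, `p' = p² + f²`. -/
theorem mul_mul_eq_of_hasDerivAt {I : Set ℝ} (hI : IsOpen I) (hc : IsPreconnected I)
    (h0 : (0 : ℝ) ∈ I) {f p : ℝ → ℝ} (hpos : ∀ t ∈ I, 0 < f t)
    (hf : ∀ t ∈ I, HasDerivAt f (2 * p t * f t) t)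
    (hp : ∀ t ∈ I, HasDerivAt p (p t ^ 2 + f t ^ 2) t) {t : ℝ} (ht : t ∈ I) :
    f t * (1 - (f 0 + p 0) * t) * (1 + (f 0 - p 0) * t) = f 0 := by
  have hconst : ∀ g : ℝ → ℝ, (∀ t ∈ I, HasDerivAt g 0 t) → ∀ t ∈ I, g t = g 0 := fun g hg t ht =>
    hI.is_const_of_deriv_eq_zero hc (fun s hs => (hg s hs).differentiableAt.differentiableWithinAt)
      (fun s hs => (hg s hs).deriv) ht h0
  -- The functions `p ± f` solve `u' = u²` but may vanish, so the positive `f` is inverted instead.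
  -- This first integral `k` is the derivative of `p / f`, and `(1 / f)' = -2 p / f`; hence `1 / f`
  -- is a quadratic polynomial in `t`.
  have h1 : ∀ t ∈ I, (f t ^ 2 - p t ^ 2) / f t = (f 0 ^ 2 - p 0 ^ 2) / f 0 := by
    refine hconst (fun t => (f t ^ 2 - p t ^ 2) / f t) fun t ht => ?_
    refine ((((hf t ht).fun_pow 2).fun_sub ((hp t ht).fun_pow 2)).fun_div (hf t ht)
      (hpos t ht).ne').congr_deriv ?_
    have := (hpos t ht).ne'
    field_simp
    ring
  set k := (f 0 ^ 2 - p 0 ^ 2) / f 0 with hk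
  have h2 : ∀ t ∈ I, p t / f t - k * t = p 0 / f 0 - k * 0 := by
    refine hconst (fun t => p t / f t - k * t) fun t ht => ?_
    refine (((hp t ht).fun_div (hf t ht) (hpos t ht).ne').fun_sub
      ((hasDerivAt_id t).const_mul k)).congr_deriv ?_
    have := (hpos t ht).ne'
    rw [← h1 t ht]
    field_simp
    ring
  have h3 : ∀ t ∈ I, (f t)⁻¹ + 2 * (p 0 / f 0) * t + k * t ^ 2 =
      (f 0)⁻¹ + 2 * (p 0 / f 0) * 0 + k * 0 ^ 2 := by
    refine hconst (fun t => (f t)⁻¹ + 2 * (p 0 / f 0) * t + k * t ^ 2) fun t ht => ?_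
    refine ((((hf t ht).fun_inv (hpos t ht).ne').fun_add
      ((hasDerivAt_id t).const_mul (2 * (p 0 / f 0)))).fun_add
      (((hasDerivAt_id t).fun_pow 2).const_mul k)).congr_deriv ?_
    have h4 : p t / f t = p 0 / f 0 + k * t := by linarith [h2 t ht]
    have h5 : -(2 * p t * f t) / f t ^ 2 = -2 * (p t / f t) := by
      have := (hpos t ht).ne'
      field_simp
    rw [h5, h4]
    simp
    ring
  have h6 := h3 t ht
  have hf0 := (hpos 0 h0).ne'
  have hft := (hpos t ht).ne'
  have h7 : (f t)⁻¹ = (f 0)⁻¹ - 2 * (p 0 / f 0) * t - k * t ^ 2 := by linarith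
  have h8 : (f t)⁻¹ * f 0 = (1 - (f 0 + p 0) * t) * (1 + (f 0 - p 0) * t) := by
    rw [h7, hk]
    field_simp
    ring
  rw [mul_assoc, ← h8, ← mul_assoc, mul_inv_cancel₀ hft, one_mul]

/-- An unbounded solution on `[0, 1 / α)` has its pole at the end point. -/
theorem eq_of_not_bounded {f : ℝ → ℝ} {α A B f₀ : ℝ} (hα : 0 < α) (hf₀ : 0 < f₀)
    (hAB : A + B = 2 * f₀)
    (hf : ∀ t, 0 ≤ t → α * t < 1 → f t * (1 - A * t) * (1 + B * t) = f₀)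
    (hub : ¬∃ M, ∀ t, 0 ≤ t → α * t < 1 → f t ≤ M) : A = α := by
  have hA : A ≤ α := by
    by_contra! h
    have hA0 := hα.trans h
    -- If `A > α`, the zero `1 / A` of the left side lies inside the interval, where the product
    -- must be `f₀ > 0`.
    have := hf A⁻¹ (inv_nonneg.2 hA0.le) (by rwa [← div_eq_mul_inv, div_lt_one hA0])
    rw [mul_inv_cancel₀ hA0.ne', sub_self, mul_zero, zero_mul] at this
    exact hf₀.ne this
  by_contra hne
  have hA' : A < α := lt_of_le_of_ne hA hne
  -- Since `-B = A - 2 f₀ < α`, neither factor of the denominator approaches zero and `f` would be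
  -- bounded.
  have hB : -B < α := by linarith
  refine hub ⟨f₀ / (min 1 (1 - A / α) * min 1 (1 + B / α)), fun t h0 h1 => ?_⟩
  -- An affine function on `[0, 1 / α]` is at least the smaller of its end values.
  have hlin : ∀ c, c < α → min 1 (1 - c / α) ≤ 1 - c * t := by
    intro c hc
    rcases le_or_gt c 0 with h | h
    · exact (min_le_left _ _).trans (by nlinarith)
    · refine (min_le_right _ _).trans (sub_le_sub_left ?_ _)
      rw [le_div_iff₀ hα]
      nlinarith
  have hminpos : ∀ c, c < α → 0 < min 1 (1 - c / α) := fun c hc =>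
    lt_min one_pos (sub_pos.2 ((div_lt_one hα).2 hc))
  have e1 := hlin A hA'
  have p1 := hminpos A hA'
  have e2 := hlin (-B) hB
  have p2 := hminpos (-B) hB
  rw [neg_div, sub_neg_eq_add] at e2 p2
  rw [neg_mul, sub_neg_eq_add] at e2
  have h2 : f t = f₀ / ((1 - A * t) * (1 + B * t)) := by
    rw [eq_div_iff (mul_pos (p1.trans_le e1) (p2.trans_le e2)).ne', ← mul_assoc, hf t h0 h1]
  have q1 : 0 ≤ 1 - A * t := (p1.trans_le e1).le
  rw [h2]
  gcongr

/-- A complete projectively flat metric of constant flag curvature `-1` is the Hilbert metric. -/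
theorem IsStronglyConvex.eq_hilbertMetric (hn : 2 ≤ n) (hF : IsStronglyConvex U F) (hU : IsOpen U)
    (hconv : Convex ℝ U) (hbdd : Bornology.IsBounded U) (hflat : IsProjectivelyFlat U F)
    (hcomp : IsComplete U F) (hK : HasConstantFlagCurvature U F (-1)) (hx : x ∈ U) (y : Space n) :
    F x y = hilbertMetric U x y := by
  rcases eq_or_ne y 0 with rfl | hy
  · rw [hF.apply_zero hx, hilbertMetric, neg_zero, funkMetric_zero]
    ring
  have hP := hF.isSmoothOffZero_projectiveFactor hU
  have hP1 := hF.isHomogeneous_projectiveFactor hU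
  have hG : ∀ x ∈ U, ∀ y, y ≠ 0 → ∀ k, sprayCoeff F k x y = projectiveFactor F x y * y k :=
    fun x hx y hy k => hF.sprayCoeff_eq_mul hU hx hy
      (hF.sprayDefect_of_isProjectivelyFlat hU hflat hx hy) k
  set I : Set ℝ := {t | x + t • y ∈ U} with hI
  have hcont : Continuous fun t : ℝ => x + t • y := by fun_prop
  have hIo : IsOpen I := hU.preimage hcont
  have hIc : Convex ℝ I := by
    have := hconv.affine_preimage (AffineMap.lineMap x (x + y) : ℝ →ᵃ[ℝ] Space n)
    have e : I = (AffineMap.lineMap x (x + y) : ℝ →ᵃ[ℝ] Space n) ⁻¹' U := by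
      ext t
      simp [hI, AffineMap.lineMap_apply, add_comm]
    rwa [e]
  have h0 : (0 : ℝ) ∈ I := by simpa [hI] using hx
  set f : ℝ → ℝ := fun t => F (x + t • y) y with hf
  set p : ℝ → ℝ := fun t => projectiveFactor F (x + t • y) y with hp
  have hpos : ∀ t ∈ I, 0 < f t := fun t ht => hF.pos _ ht _ hy
  have hfd : ∀ t ∈ I, HasDerivAt f (2 * p t * f t) t := by
    intro t ht
    refine (hF.isSmoothOffZero.hasDerivAt_line hU ht hy).congr_deriv ?_
    have hne := (hpos t ht).ne'
    have e : geodesicDerivative F (x + t • y) y =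
        2 * F (x + t • y) y * ∑ i, y i * partialX i F (x + t • y) y := by
      simp only [geodesicDerivative, hF.partialX_lagrangian hU ht hy, Finset.mul_sum]
      exact Finset.sum_congr rfl fun i _ => by ring
    simp only [hp, projectiveFactor, e, lagrangian]
    simp only [hf] at hne ⊢
    field_simp
    ring
  have hpd : ∀ t ∈ I, HasDerivAt p (p t ^ 2 + f t ^ 2) t := by
    intro t ht
    refine (hP.hasDerivAt_line hU ht hy).congr_deriv ?_
    have := hF.sq_sub_sum_partialX_of_flagCurvature hU hn hP hP1 hG hK ht hy
    simp only [hp, hf]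
    linarith
  have key := fun t (ht : t ∈ I) => mul_mul_eq_of_hasDerivAt hIo hIc.isPreconnected h0 hpos hfd hpd ht
  have hf0 : f 0 = F x y := by simp [hf]
  have h1 : f 0 + p 0 = funkMetric U x y := by
    refine eq_of_not_bounded (f := f) (B := f 0 - p 0) (funkMetric_pos hU hx hbdd hy) (hpos 0 h0)
      (by ring) (fun t h0 ht => key t (add_smul_mem_of_lt hU hx hconv h0 ht))
      (hF.not_bounded_of_isForwardComplete hU hconv hbdd hx hy hcomp.1)
  -- The reflection `t ↦ -t` exchanges the two linear factors. Here `F (x - t y, y)` measures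
  -- vectors pointing against the ray towards `-y`, so backward completeness is what applies.
  have h2 : f 0 - p 0 = funkMetric U x (-y) := by
    refine eq_of_not_bounded (f := fun t => f (-t)) (B := f 0 + p 0)
      (funkMetric_pos hU hx hbdd (neg_ne_zero.2 hy)) (hpos 0 h0) (by ring) (fun t h0 ht => ?_) ?_
    · have hm := add_smul_mem_of_lt hU hx hconv h0 ht
      rw [smul_neg, ← neg_smul] at hm
      linear_combination key (-t) hm
    · have := hF.not_bounded_of_isBackwardComplete hU hconv hbdd hx (neg_ne_zero.2 hy) hcomp.2
      simpa only [neg_neg, smul_neg, ← neg_smul] using this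
  rw [hilbertMetric, ← h1, ← h2, hf0]
  ring

end

end Finsler

/-! ### The equivalence -/

theorem theoremA (n : ℕ) (hn : 2 ≤ n) (U : Set (Finsler.Space n)) (hopen : IsOpen U)
    (hconv : Convex ℝ U) (hbdd : Bornology.IsBounded U)
    (F : Finsler.Space n → Finsler.Space n → ℝ) (hF : Finsler.IsStronglyConvex U F) :
    (∀ x ∈ U, ∀ ξ : Finsler.Space n, F x ξ = Finsler.hilbertMetric U x ξ) ↔
      (Finsler.IsProjectivelyFlat U F ∧ Finsler.IsComplete U F ∧
        Finsler.HasConstantFlagCurvature U F (-1)) :=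
  ⟨fun hH => ⟨hF.isProjectivelyFlat_of_hilbert hopen hconv hbdd hH,
    hF.isComplete_of_hilbert hopen hconv hbdd hH,
    hF.hasConstantFlagCurvature_of_hilbert hopen hconv hbdd hH⟩,
    fun h _ hx ξ => hF.eq_hilbertMetric hn hopen hconv hbdd h.1 h.2.1 h.2.2 hx ξ⟩
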